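/- Consider the following two cases. **Case S.** Let $I$ be a countable index set. Let $E=\ell_1(I)$ and $F=\ell_\infty(I)$ be the real sequence spaces with their norms $\|\cdot\|_1$ and $\|\cdot\|_\infty$, and put $\langle a,b\rangle=\sum_i a_ib_i$ for $a\in F$, $b\in E$. The *states* are the $\omega\in E$ with $\omega_i\ge 0$ for all $i$ and $\sum_i\omega_i=1$. Put $\mathrm{entropy}(\omega)=-\sum_i\omega_i\ln\omega_i\in[0,\infty]$. **Case O.** Let $\mathcal H$ be a separable complex Hilbert space. Let $E$ be the real space of Hermitian trace-class operators on $\mathcal H$ with the trace norm $\|a\|_1=\operatorname{tr}|a|$, let $F$ be the real space of Hermitian bounded operators with the operator norm $\|\cdot\|_\infty$, and put $\langle a,b\rangle=\operatorname{tr}(ab)$ for $a\in F$, $b\in E$. The *states* are the positive semidefinite $\omega\in E$ with $\operatorname{tr}\omega=1$. Put $\mathrm{entropy}(\omega)=-\sum_i\omega_i\ln\omega_i\in[0,\infty]$, where $(\omega_i)$ are the eigenvalues of $\omega$, counted with multiplicity. In either case $E\subseteq F$. Let $X$ be a $\|\cdot\|_1$-closed real linear subspace of $E$ that is the closed linear span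 of the states it contains. Suppose that every state $\omega$ has a *conditional expectation* in $X$, that is, a state $\omega_X\in X$ with $\langle\omega_X,a\rangle=\langle\omega,a\rangle$ for all $a\in X$. Then: 1. There are direct-sum decompositions $E=X\oplus\{b\in E:\langle b,a\rangle=0\ \forall a\in X\}$ and $F=\overline{X}\oplus\{b\in F:\langle b,a\rangle=0\ \forall a\in X\}$, where $\overline X$ is the closure of $X$ in $F$ in the weak-* topology $\sigma(F,E)$. The projection $\pi_X$ of $F$ on $\overline X$ in the second decomposition restricts on $E$ to the projection on $X$ in the first, and $$\|\pi_X(a)\|_1\le\|a\|_1\quad(a\in E),\qquad \|\pi_X(a)\|_\infty\le\|a\|_\infty\quad(a\in F).$$ Every state $\omega$ has exactly one conditional expectation in $X$, namely $\omega_X=\pi_X(\omega)$. 2. Taking the conditional expectation is entropy non-decreasing: $\mathrm{entropy}(\omega)\le\mathrm{entropy}(\omega_X)$ for every state $\omega$. -/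

import Mathlib

open scoped ENNReal InnerProductSpace Topology

noncomputable section

/-! ### Trace-class Hermitian operators on a complex Hilbert space -/

section TraceClass

theorem ofReal_norm_sq_eq_tsum {H : Type*} [NormedAddCommGroup H] [InnerProductSpace ℂ H]
    {κ : Type*} (f : HilbertBasis κ ℂ H) (x : H) :
    ENNReal.ofReal (‖x‖ ^ 2) = ∑' j, ENNReal.ofReal (‖⟪f j, x⟫_ℂ‖ ^ 2) := by
  have h := (f.hasSum_inner_mul_inner x x).mapL (RCLike.reCLM (K := ℂ))
  have h2 : HasSum (fun j => ‖⟪f j, x⟫_ℂ‖ ^ 2) (‖x‖ ^ 2) := by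
    have h3 : (fun j => RCLike.reCLM (K := ℂ) (⟪x, f j⟫_ℂ * ⟪f j, x⟫_ℂ)) =
        fun j => ‖⟪f j, x⟫_ℂ‖ ^ 2 := by
      funext j
      rw [← inner_conj_symm x (f j), RCLike.conj_mul, RCLike.reCLM_apply]
      norm_cast
    have h4 : RCLike.reCLM (K := ℂ) ⟪x, x⟫_ℂ = ‖x‖ ^ 2 := by
      rw [RCLike.reCLM_apply, inner_self_eq_norm_sq]
    rw [h3, h4] at h
    exact h
  rw [← h2.tsum_eq, ENNReal.ofReal_tsum_of_nonneg (fun _ => by positivity) h2.summable]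

variable {H : Type*} [NormedAddCommGroup H] [InnerProductSpace ℂ H] [CompleteSpace H]

/-- `∑ i, ⟪e i, T (e i)⟫ ∈ [0, ∞]` in the orthonormal basis `e`, for a positive operator `T`. -/
def diagSum {κ : Type*} (e : HilbertBasis κ ℂ H) (T : H →L[ℂ] H) : ℝ≥0∞ :=
  ∑' i, ENNReal.ofReal (RCLike.re ⟪e i, T (e i)⟫_ℂ)

/-- The diagonal sum of a positive operator does not depend on the orthonormal basis. -/
theorem diagSum_eq_diagSum {κ κ' : Type*} (e : HilbertBasis κ ℂ H) (f : HilbertBasis κ' ℂ H)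
    {T : H →L[ℂ] H} (hT : 0 ≤ T) : diagSum e T = diagSum f T := by
  have hS : IsSelfAdjoint (CFC.sqrt T) := (CFC.sqrt_nonneg T).isSelfAdjoint
  have hSS : CFC.sqrt T * CFC.sqrt T = T := CFC.sqrt_mul_sqrt_self T hT
  have hsym : ∀ x y : H, ⟪CFC.sqrt T x, y⟫_ℂ = ⟪x, CFC.sqrt T y⟫_ℂ := hS.isSymmetric
  have key : ∀ x : H, RCLike.re ⟪x, T x⟫_ℂ = ‖CFC.sqrt T x‖ ^ 2 := by
    intro x
    conv_lhs => rw [← hSS, mul_apply_eq_comp, ← hsym, inner_self_eq_norm_sq]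
  simp only [diagSum, key]
  calc _ = ∑' i, ∑' j, ENNReal.ofReal (‖⟪f j, CFC.sqrt T (e i)⟫_ℂ‖ ^ 2) :=
        tsum_congr fun i => ofReal_norm_sq_eq_tsum f _
    _ = ∑' j, ∑' i, ENNReal.ofReal (‖⟪f j, CFC.sqrt T (e i)⟫_ℂ‖ ^ 2) := ENNReal.tsum_comm
    _ = ∑' j, ∑' i, ENNReal.ofReal (‖⟪e i, CFC.sqrt T (f j)⟫_ℂ‖ ^ 2) := by
        refine tsum_congr fun j => tsum_congr fun i => ?_
        rw [← hsym, norm_inner_symm]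
    _ = _ := tsum_congr fun j => (ofReal_norm_sq_eq_tsum e _).symm

variable (H) in
/-- An orthonormal basis of `H`, fixed once and for all; `traceNorm_eq` shows that the choice does
not matter. -/
def onb : HilbertBasis (exists_hilbertBasis ℂ H).choose ℂ H :=
  (exists_hilbertBasis ℂ H).choose_spec.choose

/-- The trace norm `‖T‖₁ = tr |T| ∈ [0, ∞]`, where `|T| = (T* T)^(1/2)`. -/
def traceNorm (T : H →L[ℂ] H) : ℝ≥0∞ := diagSum (onb H) (CFC.abs T)

theorem traceNorm_eq {κ : Type*} (e : HilbertBasis κ ℂ H) (T : H →L[ℂ] H) :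
    traceNorm T = diagSum e (CFC.abs T) :=
  diagSum_eq_diagSum _ _ (CFC.abs_nonneg T)

theorem traceNorm_zero : traceNorm (0 : H →L[ℂ] H) = 0 := by
  simp [traceNorm, diagSum]

theorem traceNorm_smul (c : ℝ) (T : H →L[ℂ] H) :
    traceNorm (c • T) = ENNReal.ofReal |c| * traceNorm T := by
  have h : CFC.abs (c • T) = |c| • CFC.abs T := by
    rw [CFC.abs_smul, Real.norm_eq_abs]
  simp only [traceNorm, diagSum, h, ← ENNReal.tsum_mul_left]
  refine tsum_congr fun i => ?_
  rw [← ENNReal.ofReal_mul (abs_nonneg c)]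
  congr 1
  rw [smul_apply, inner_smul_right_eq_smul]
  simp

theorem traceNorm_eq_zero {T : H →L[ℂ] H} (h : traceNorm T = 0) : T = 0 := by
  have hp := CFC.abs_nonneg T
  have hS : IsSelfAdjoint (CFC.sqrt (CFC.abs T)) := (CFC.sqrt_nonneg _).isSelfAdjoint
  have hSS := CFC.sqrt_mul_sqrt_self (CFC.abs T) hp
  have hz : ∀ i, CFC.sqrt (CFC.abs T) (onb H i) = 0 := by
    intro i
    have h1 := ENNReal.tsum_eq_zero.1 h i
    rw [ENNReal.ofReal_eq_zero, ← hSS, mul_apply_eq_comp] at h1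
    have h2 : ⟪CFC.sqrt (CFC.abs T) (onb H i), CFC.sqrt (CFC.abs T) (onb H i)⟫_ℂ =
      ⟪onb H i, CFC.sqrt (CFC.abs T) (CFC.sqrt (CFC.abs T) (onb H i))⟫_ℂ := hS.isSymmetric _ _
    rw [← h2, inner_self_eq_norm_sq] at h1
    exact norm_eq_zero.1 (pow_eq_zero_iff two_ne_zero |>.1 (le_antisymm h1 (by positivity)))
  have h0 : CFC.sqrt (CFC.abs T) = 0 := by
    refine ContinuousLinearMap.ext_on
      (Submodule.dense_iff_topologicalClosure_eq_top.2 (onb H).dense_span) ?_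
    rintro _ ⟨i, rfl⟩
    simpa using hz i
  rw [h0, zero_mul] at hSS
  exact CFC.abs_eq_zero_iff.1 hSS.symm

/-- The triangle inequality for the trace norm on Hermitian operators. -/
theorem traceNorm_add_le {A B : H →L[ℂ] H} (hA : IsSelfAdjoint A) (hB : IsSelfAdjoint B) :
    traceNorm (A + B) ≤ traceNorm A + traceNorm B := by
  set C := A + B with hC
  have hCs : IsSelfAdjoint C := hA.add hB
  -- an orthonormal basis adapted to the closure `K` of the range of the positive part of `C`
  let K : Submodule ℂ H := (LinearMap.range (C⁺ : H →L[ℂ] H).toLinearMap).topologicalClosure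
  obtain ⟨w, b, hb⟩ := exists_hilbertBasis ℂ K
  have hs : Orthonormal ℂ ((↑) : (Set.range fun i => (b i : H)) → H) :=
    (b.orthonormal.comp_linearIsometry K.subtypeₗᵢ).toSubtypeRange
  obtain ⟨v, e, hv, he⟩ := hs.exists_hilbertBasis_extension
  rw [traceNorm_eq e, traceNorm_eq e, traceNorm_eq e, diagSum, diagSum, diagSum,
    ← ENNReal.tsum_add]
  have hle : ∀ {D : H →L[ℂ] H}, IsSelfAdjoint D → ∀ x : H,
      |RCLike.re ⟪x, D x⟫_ℂ| ≤ RCLike.re ⟪x, CFC.abs D x⟫_ℂ := by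
    intro D hD x
    have h1 : 0 ≤ CFC.abs D - D := by
      rw [CFC.abs_sub_self D hD]; exact smul_nonneg (by norm_num) (CFC.negPart_nonneg D)
    have h2 : 0 ≤ CFC.abs D + D := by
      rw [CFC.abs_add_self D hD]; exact smul_nonneg (by norm_num) (CFC.posPart_nonneg D)
    have h1' := ((ContinuousLinearMap.nonneg_iff_isPositive _).1 h1).re_inner_nonneg_right x
    have h2' := ((ContinuousLinearMap.nonneg_iff_isPositive _).1 h2).re_inner_nonneg_right x
    simp only [sub_apply, add_apply, inner_sub_right,
      inner_add_right, map_sub, map_add] at h1' h2'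
    exact abs_le.2 ⟨by linarith, by linarith⟩
  have habs : ∀ x, (C⁺ x = 0 ∨ C⁻ x = 0) →
      RCLike.re ⟪x, CFC.abs C x⟫_ℂ ≤ |RCLike.re ⟪x, C x⟫_ℂ| := by
    intro x hx
    rw [← CFC.posPart_add_negPart C hCs]
    conv_rhs => rw [← CFC.posPart_sub_negPart C hCs]
    rcases hx with hx | hx
    · simp only [sub_apply, add_apply, hx, zero_add,
        zero_sub, inner_neg_right, map_neg, abs_neg]
      exact le_abs_self _
    · simp only [sub_apply, add_apply, hx, add_zero,
        sub_zero]
      exact le_abs_self _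
  have hker : ∀ x ∈ K, C⁻ x = 0 := by
    intro x hx
    have hsub : K ≤ LinearMap.ker (C⁻ : H →L[ℂ] H).toLinearMap := by
      refine Submodule.topologicalClosure_minimal _ ?_ (ContinuousLinearMap.isClosed_ker _)
      rintro _ ⟨y, rfl⟩
      have := congrArg (fun D : H →L[ℂ] H => D y) (CFC.negPart_mul_posPart C)
      exact this
    exact hsub hx
  have hperp : ∀ x ∈ Kᗮ, C⁺ x = 0 := by
    intro x hx
    have hps : IsSelfAdjoint (C⁺) := (CFC.posPart_nonneg C).isSelfAdjoint
    have hsym : ⟪C⁺ (C⁺ x), x⟫_ℂ = ⟪C⁺ x, C⁺ x⟫_ℂ := hps.isSymmetric (C⁺ x) x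
    have h0 := hx (C⁺ (C⁺ x)) (Submodule.le_topologicalClosure _ ⟨C⁺ x, rfl⟩)
    rw [hsym] at h0
    exact inner_self_eq_zero.1 h0
  have hcase : ∀ i, C⁺ (e i) = 0 ∨ C⁻ (e i) = 0 := by
    intro i
    have hei : e i = (i : H) := by rw [he]
    by_cases hi : (i : H) ∈ Set.range fun j => (b j : H)
    · right
      obtain ⟨j, hj⟩ := hi
      rw [hei, ← hj]
      exact hker _ (b j).2
    · left
      apply hperp
      have hort : ∀ j, ⟪(b j : H), e i⟫_ℂ = 0 := by
        intro j
        have hj : (b j : H) ∈ v := hv ⟨j, rfl⟩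
        have hej : e ⟨b j, hj⟩ = (b j : H) := by rw [he]
        rw [← hej]
        refine e.orthonormal.2 fun h => hi ?_
        exact ⟨j, congrArg Subtype.val h⟩
      rw [Submodule.mem_orthogonal]
      intro u hu
      have hd : (⟨u, hu⟩ : K) ∈ (Submodule.span ℂ (Set.range b)).topologicalClosure := by
        rw [b.dense_span]; trivial
      let φ : K →L[ℂ] ℂ := (innerSL ℂ (e i)).comp K.subtypeL
      have hφ : (Submodule.span ℂ (Set.range b)).topologicalClosure ≤
          LinearMap.ker φ.toLinearMap := by
        refine Submodule.topologicalClosure_minimal _ ?_ (ContinuousLinearMap.isClosed_ker _)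
        rw [Submodule.span_le]
        rintro _ ⟨j, rfl⟩
        have := inner_eq_zero_symm.1 (hort j)
        simpa [φ] using this
      have := hφ hd
      refine inner_eq_zero_symm.1 ?_
      simpa [φ] using this
  refine ENNReal.tsum_le_tsum fun i => ?_
  have hnn : ∀ D : H →L[ℂ] H, 0 ≤ RCLike.re ⟪e i, CFC.abs D (e i)⟫_ℂ := fun D =>
    ((ContinuousLinearMap.nonneg_iff_isPositive _).1 (CFC.abs_nonneg D)).re_inner_nonneg_right _
  rw [← ENNReal.ofReal_add (hnn A) (hnn B)]
  refine ENNReal.ofReal_le_ofReal ?_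
  calc _ ≤ |RCLike.re ⟪e i, C (e i)⟫_ℂ| := habs _ (hcase i)
    _ ≤ |RCLike.re ⟪e i, A (e i)⟫_ℂ| + |RCLike.re ⟪e i, B (e i)⟫_ℂ| := by
        rw [hC, add_apply, inner_add_right, map_add]
        exact abs_add_le _ _
    _ ≤ _ := add_le_add (hle hA _) (hle hB _)

variable (H) in
/-- The real space of Hermitian bounded operators, with the operator norm `‖·‖_∞`. -/
abbrev HermBounded : Type _ := selfAdjoint (H →L[ℂ] H)

variable (H) in
/-- The real vector space of Hermitian trace-class operators, inside the Hermitian bounded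
operators. -/
def hermTraceClass : Submodule ℝ (HermBounded H) where
  carrier := {T | traceNorm (T : H →L[ℂ] H) < ∞}
  zero_mem' := by simp [traceNorm_zero]
  add_mem' := fun {A B} hA hB =>
    (traceNorm_add_le A.2 B.2).trans_lt (ENNReal.add_lt_top.2 ⟨hA, hB⟩)
  smul_mem' := fun c A hA => by
    show traceNorm (c • (A : H →L[ℂ] H)) < ∞
    rw [traceNorm_smul]
    exact ENNReal.mul_lt_top ENNReal.ofReal_lt_top hA

variable (H) in
/-- The Hermitian trace-class operators, as a space to be normed by `‖·‖₁` (and not by the operator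
norm, hence the type synonym). -/
def HermTraceClass : Type _ := hermTraceClass H

instance : AddCommGroup (HermTraceClass H) := inferInstanceAs (AddCommGroup (hermTraceClass H))

instance : Module ℝ (HermTraceClass H) := inferInstanceAs (Module ℝ (hermTraceClass H))

/-- The inclusion of the Hermitian trace-class operators in the Hermitian bounded operators. -/
def HermTraceClass.toBounded (T : HermTraceClass H) : HermBounded H :=
  (show hermTraceClass H from T).1

instance : Norm (HermTraceClass H) := ⟨fun T => (traceNorm (T.toBounded : H →L[ℂ] H)).toReal⟩

theorem HermTraceClass.normCore : NormedSpace.Core ℝ (HermTraceClass H) where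
  norm_nonneg _ := ENNReal.toReal_nonneg
  norm_smul c T := by
    show (traceNorm (c • (T.toBounded : H →L[ℂ] H))).toReal = _
    rw [traceNorm_smul, ENNReal.toReal_mul, ENNReal.toReal_ofReal (abs_nonneg c)]
    rfl
  norm_triangle A B := by
    have hA : traceNorm (A.toBounded : H →L[ℂ] H) < ∞ := (show hermTraceClass H from A).2
    have hB : traceNorm (B.toBounded : H →L[ℂ] H) < ∞ := (show hermTraceClass H from B).2
    show (traceNorm ((A.toBounded : H →L[ℂ] H) + (B.toBounded : H →L[ℂ] H))).toReal ≤ _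
    refine (ENNReal.toReal_mono (ENNReal.add_lt_top.2 ⟨hA, hB⟩).ne
      (traceNorm_add_le A.toBounded.2 B.toBounded.2)).trans ?_
    rw [ENNReal.toReal_add hA.ne hB.ne]
    exact le_rfl
  norm_eq_zero_iff T := by
    have hT : traceNorm (T.toBounded : H →L[ℂ] H) < ∞ := (show hermTraceClass H from T).2
    constructor
    · intro h
      rcases (ENNReal.toReal_eq_zero_iff _).1 h with h | h
      · exact Subtype.ext (Subtype.ext (traceNorm_eq_zero h))
      · exact absurd h hT.ne
    · rintro rfl
      show (traceNorm (0 : H →L[ℂ] H)).toReal = 0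
      rw [traceNorm_zero, ENNReal.toReal_zero]

instance : NormedAddCommGroup (HermTraceClass H) := NormedAddCommGroup.ofCore HermTraceClass.normCore

instance : NormedSpace ℝ (HermTraceClass H) := NormedSpace.ofCore HermTraceClass.normCore

end TraceClass

/-! ### Case S: sequences -/

section Sequences

variable {ι : Type*}

variable (ι) in
/-- The real space `ℓ₁` with `‖·‖₁`. -/
abbrev SeqL1 : Type _ := lp (fun _ : ι => ℝ) 1

variable (ι) in
/-- The real space `ℓ_∞` with `‖·‖_∞`. -/
abbrev SeqLinf : Type _ := lp (fun _ : ι => ℝ) ∞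

/-- The inclusion `ℓ₁ ⊆ ℓ_∞`. -/
def SeqL1.toLinf (a : SeqL1 ι) : SeqLinf ι := ⟨a.1, lp.monotone le_top a.2⟩

/-- The pairing `⟨a, b⟩ = ∑ a_i b_i` of `a ∈ ℓ_∞` and `b ∈ ℓ₁`. -/
def seqPairing (a : SeqLinf ι) (b : SeqL1 ι) : ℝ := ∑' i, a i * b i

variable (ι) in
/-- The nonnegative sequences with sum 1 (discrete probability distributions). -/
def seqStates : Set (SeqL1 ι) := {ω | (∀ i, 0 ≤ ω i) ∧ ∑' i, ω i = 1}

/-- `- ∑ ω_i ln ω_i ∈ [0, ∞]`. -/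
def seqEntropy (ω : SeqL1 ι) : ℝ≥0∞ := ∑' i, ENNReal.ofReal (Real.negMulLog (ω i))

end Sequences

/-! ### Case O: operators -/

section Operators

variable {H : Type*} [NormedAddCommGroup H] [InnerProductSpace ℂ H] [CompleteSpace H]

/-- The trace of a trace-class operator. -/
def opTrace (T : H →L[ℂ] H) : ℂ := ∑' i, ⟪onb H i, T (onb H i)⟫_ℂ

/-- The pairing `⟨a, b⟩ = tr (a b)` of a bounded and a trace-class Hermitian operator. It is a real
number, because `a` and `b` are Hermitian. -/
def opPairing (a : HermBounded H) (b : HermTraceClass H) : ℝ :=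
  (opTrace ((a : H →L[ℂ] H) * (b.toBounded : H →L[ℂ] H))).re

variable (H) in
/-- The positive trace-class operators with trace 1. -/
def opStates : Set (HermTraceClass H) :=
  {ω | (ω.toBounded : H →L[ℂ] H).IsPositive ∧ opTrace (ω.toBounded : H →L[ℂ] H) = 1}

/-- `- ∑ ω_i ln ω_i ∈ [0, ∞]` for the eigenvalues `ω_i`, each eigenvalue `t` being counted as often
as its multiplicity says. -/
def opEntropy (ω : HermTraceClass H) : ℝ≥0∞ :=
  ∑' t : ℝ,
    (Module.finrank ℂ
      (Module.End.eigenspace (ω.toBounded : H →L[ℂ] H).toLinearMap (t : ℂ)) : ℝ≥0∞) *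
      ENNReal.ofReal (Real.negMulLog t)

end Operators

/-! ### Notions common to both cases

`E` is the real `‖·‖₁`-space, `F` the real `‖·‖_∞`-space, `j : E → F` the inclusion and
`p : F → E → ℝ` the pairing. -/

section Common

variable {E F : Type*}

/-- `ωX` is a conditional expectation in `X` of `ω`: a state in `X` with `⟨ωX, a⟩ = ⟨ω, a⟩` for all
`a` in `X`. -/
def IsCondExpectation (j : E → F) (p : F → E → ℝ) (states X : Set E) (ω ωX : E) : Prop :=
  ωX ∈ X ∩ states ∧ ∀ a ∈ X, p (j ωX) a = p (j ω) a

/-- The annihilator of `X ⊆ E` in `F`. -/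
def annihilator (p : F → E → ℝ) (X : Set E) : Set F := {f | ∀ a ∈ X, p f a = 0}

/-- The weak-* topology `σ(F, E)` on `F`: the coarsest one making all `⟨·, b⟩`, `b ∈ E`,
continuous. -/
abbrev weakStarTopology (p : F → E → ℝ) : TopologicalSpace F :=
  TopologicalSpace.induced p Pi.topologicalSpace

/-- `π` is the linear projection on `R` in a direct-sum decomposition `R ⊕ K`. -/
structure IsProjectionAlong [NormedAddCommGroup E] [NormedSpace ℝ E] (π : E →L[ℝ] E)
    (R K : Set E) : Prop where
  idem : ∀ a, π (π a) = π a
  range_eq : Set.range π = R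
  ker_eq : {a | π a = 0} = K

end Common

end

noncomputable section

/-! ### Entropy under doubly stochastic matrices -/

section DoublyStochastic

/-! The form `p (j a) b` is symmetric and definite on `E`, and a conditional expectation is an
orthogonal projection on `X` for this form. Elements of `X` are therefore determined by their
pairings with `X`, so conditional expectations are unique. Every `a` in `E` is a difference of
nonnegative multiples of states whose norms add up to at most `‖a‖`; hence conditional expectations
extend to a linear contraction `π₁` of `E` onto `X`, symmetric for the form.

`F` is the dual of `E`, so `π₁` has an adjoint `π₂` on `F`, again a contraction, and symmetry of
`π₁` says that `π₂` extends `π₁`. By definiteness `E` is weak-* dense in `F`; hence `X` is weak-*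
dense in the range of `π₂`, and that range is weak-* closed (`IsStateDuality.exists_projections`).

For the entropy, decompose `ω` into pure states `G k` with weights `w k` and `π₁ ω` into pure states
`G' i` with weights `m i`. Since `π₁` is symmetric and preserves states, the matrix `P i k = ⟨π₁ (G'
i), G k⟩` is doubly stochastic, and `m i = ∑ w k * P i k`. Jensen's inequality for `Real.negMulLog`
gives the claim (`IsStateDuality.entropy_le`).

The two cases enter only through `IsStateDuality` and `HasSpectralEntropy`. For sequences the pure
states are the unit vectors. For operators they are the rank-one projections on an eigenbasis; the
work there is to diagonalize trace-class operators (`exists_isEigenbasis`), to compute traces in any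
basis (`IsEigenbasis.hasSum_inner_mul`), and to represent functionals by bounded operators
(`exists_opPairing_eq`). -/

theorem Real.negMulLog_le_tangent {w m : ℝ} (hw : 0 ≤ w) (hm : 0 < m) :
    Real.negMulLog w ≤ Real.negMulLog m + (-Real.log m - 1) * (w - m) := by
  -- At `w = 0` the right-hand side is just `m`; otherwise the claim is `log x ≤ x - 1` at `x = m /
  -- w`.
  rcases hw.eq_or_lt with rfl | hw
  · simp only [Real.negMulLog]
    nlinarith
  · have h := Real.log_le_sub_one_of_pos (div_pos hm hw)
    rw [Real.log_div hm.ne' hw.ne'] at h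
    have h2 : w * (Real.log m - Real.log w) ≤ w * (m / w - 1) := mul_le_mul_of_nonneg_left h hw.le
    have h3 : w * (m / w - 1) = m - w := by field_simp
    simp only [Real.negMulLog]
    nlinarith

/-- Jensen's inequality for countable convex combinations of numbers in `[0, 1]`. -/
theorem tsum_mul_negMulLog_le {κ : Type*} {P w : κ → ℝ} {m : ℝ} (hP : ∀ k, 0 ≤ P k)
    (hP1 : HasSum P 1) (hw : ∀ k, 0 ≤ w k) (hw1 : ∀ k, w k ≤ 1)
    (hm : HasSum (fun k => w k * P k) m) :
    ∑' k, ENNReal.ofReal (P k * Real.negMulLog (w k)) ≤ ENNReal.ofReal (Real.negMulLog m) := by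
  have hm0 : 0 ≤ m := hm.nonneg fun k => mul_nonneg (hw k) (hP k)
  have hnn : ∀ k, 0 ≤ P k * Real.negMulLog (w k) := fun k =>
    mul_nonneg (hP k) (Real.negMulLog_nonneg (hw k) (hw1 k))
  -- There is no tangent at `m = 0`, but then every `w k * P k` vanishes.
  rcases hm0.eq_or_lt with rfl | hm0
  · have h := (hasSum_zero_iff_of_nonneg fun k => mul_nonneg (hw k) (hP k)).1 hm
    have hz : ∀ k, P k * Real.negMulLog (w k) = 0 := by
      intro k
      rcases mul_eq_zero.1 (congrFun h k) with h | h <;> simp [h]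
    simp [hz]
  -- The tangent at the mean `m`, averaged with the weights `P`: its linear term sums to zero.
  · have hs : HasSum (fun k => P k * Real.negMulLog m + (-Real.log m - 1) * (w k * P k - P k * m))
        (1 * Real.negMulLog m + (-Real.log m - 1) * (m - 1 * m)) :=
      (hP1.mul_right _).add ((hm.sub (hP1.mul_right m)).mul_left _)
    have hle : ∀ k, P k * Real.negMulLog (w k) ≤
        P k * Real.negMulLog m + (-Real.log m - 1) * (w k * P k - P k * m) := by
      intro k
      have := mul_le_mul_of_nonneg_left (Real.negMulLog_le_tangent (hw k) hm0) (hP k)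
      linarith
    have hsum := Summable.of_nonneg_of_le hnn hle hs.summable
    rw [← ENNReal.ofReal_tsum_of_nonneg hnn hsum]
    refine ENNReal.ofReal_le_ofReal ?_
    calc _ ≤ _ := hsum.tsum_le_tsum hle hs.summable
      _ = _ := by rw [hs.tsum_eq]; ring

/-- A doubly stochastic matrix does not decrease the entropy. -/
theorem tsum_negMulLog_le_of_doublyStochastic {κ κ' : Type*} {P : κ' → κ → ℝ} {w : κ → ℝ}
    {m : κ' → ℝ} (hP : ∀ i k, 0 ≤ P i k) (hrow : ∀ i, HasSum (P i) 1)
    (hcol : ∀ k, HasSum (fun i => P i k) 1) (hw : ∀ k, 0 ≤ w k) (hw1 : ∀ k, w k ≤ 1)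
    (hm : ∀ i, HasSum (fun k => w k * P i k) (m i)) :
    ∑' k, ENNReal.ofReal (Real.negMulLog (w k)) ≤
      ∑' i, ENNReal.ofReal (Real.negMulLog (m i)) := by
  -- Column sums spread each term over its column; after the exchange of sums, Jensen applies to
  -- each row.
  calc ∑' k, ENNReal.ofReal (Real.negMulLog (w k))
      = ∑' k, ∑' i, ENNReal.ofReal (P i k * Real.negMulLog (w k)) := by
        refine tsum_congr fun k => ?_
        simp only [ENNReal.ofReal_mul (hP _ _)]
        rw [ENNReal.tsum_mul_right,
          ← ENNReal.ofReal_tsum_of_nonneg (fun i => hP i k) (hcol k).summable, (hcol k).tsum_eq]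
        simp
    _ = ∑' i, ∑' k, ENNReal.ofReal (P i k * Real.negMulLog (w k)) := ENNReal.tsum_comm
    _ ≤ _ := ENNReal.tsum_le_tsum fun i => tsum_mul_negMulLog_le (hP i) (hrow i) hw hw1 (hm i)

end DoublyStochastic

/-! ### Conditional expectations in an abstract state space -/

section Abstract

variable {E F : Type*} [NormedAddCommGroup E] [NormedSpace ℝ E] [NormedAddCommGroup F]
  [NormedSpace ℝ F]

/-- `F` is the dual of `E` under `p`, the form `p ∘ j` is an inner product on `E`, and every element
of `E` is a difference of multiples of states with total mass at most its norm. -/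
structure IsStateDuality (j : E →ₗ[ℝ] F) (p : F →ₗ[ℝ] E →ₗ[ℝ] ℝ) (S : Set E) : Prop where
  symm : ∀ a b, p (j a) b = p (j b) a
  definite : ∀ a, p (j a) a = 0 → a = 0
  bound : ∀ f b, |p f b| ≤ ‖f‖ * ‖b‖
  norming : ∀ f C, 0 ≤ C → (∀ b, |p f b| ≤ C * ‖b‖) → ‖f‖ ≤ C
  surj : ∀ φ : E →L[ℝ] ℝ, ∃ f, ∀ b, p f b = φ b
  norm_state : ∀ ω ∈ S, ‖ω‖ ≤ 1
  decomp : ∀ a, ∃ b c, a = b - c ∧ ‖b‖ + ‖c‖ ≤ ‖a‖ ∧ (b = 0 ∨ ‖b‖⁻¹ • b ∈ S) ∧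
    (c = 0 ∨ ‖c‖⁻¹ • c ∈ S)

variable {j : E →ₗ[ℝ] F} {p : F →ₗ[ℝ] E →ₗ[ℝ] ℝ} {S : Set E}

namespace IsStateDuality

theorem ext_pairing (h : IsStateDuality j p S) {f g : F} (hfg : ∀ b, p f b = p g b) : f = g := by
  rw [← sub_eq_zero, ← norm_le_zero_iff]
  refine h.norming _ 0 le_rfl fun b => ?_
  simp [hfg]

theorem eq_of_mem (h : IsStateDuality j p S) {X : Submodule ℝ E} {x y : E} (hx : x ∈ X)
    (hy : y ∈ X) (hxy : ∀ a ∈ X, p (j x) a = p (j y) a) : x = y := by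
  rw [← sub_eq_zero]
  refine h.definite _ ?_
  have := hxy _ (X.sub_mem hx hy)
  rw [map_sub j, map_sub p, LinearMap.sub_apply, this, sub_self]

theorem exists_pairing_eq_of_smul_mem (h : IsStateDuality j p S) {X : Submodule ℝ E}
    (hX : ∀ ω ∈ S, ∃ ωX, IsCondExpectation j (fun f e => p f e) S X ω ωX) {a : E}
    (ha : a = 0 ∨ ‖a‖⁻¹ • a ∈ S) :
    ∃ x ∈ X, ‖x‖ ≤ ‖a‖ ∧ ∀ y ∈ X, p (j x) y = p (j a) y := by
  rcases ha with rfl | ha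
  · exact ⟨0, X.zero_mem, le_rfl, fun _ _ => rfl⟩
  by_cases ha0 : a = 0
  · subst ha0; exact ⟨0, X.zero_mem, le_rfl, fun _ _ => rfl⟩
  obtain ⟨x, ⟨hxX, hxS⟩, hx⟩ := hX _ ha
  refine ⟨‖a‖ • x, X.smul_mem _ hxX, ?_, fun y hy => ?_⟩
  · rw [norm_smul, norm_norm]
    exact mul_le_of_le_one_right (norm_nonneg _) (h.norm_state x hxS)
  · have := hx y hy
    simp only [map_smul, LinearMap.smul_apply, smul_eq_mul] at this ⊢
    rw [this, mul_inv_cancel_left₀ (norm_ne_zero_iff.2 ha0)]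

/-- The norms of the two parts in `decomp` add up to at most `‖a‖`, which is why the bound carries
no constant. -/
theorem exists_pairing_eq (h : IsStateDuality j p S) {X : Submodule ℝ E}
    (hX : ∀ ω ∈ S, ∃ ωX, IsCondExpectation j (fun f e => p f e) S X ω ωX) (a : E) :
    ∃ x ∈ X, ‖x‖ ≤ ‖a‖ ∧ ∀ y ∈ X, p (j x) y = p (j a) y := by
  obtain ⟨b, c, rfl, hn, hb, hc⟩ := h.decomp a
  obtain ⟨x, hx, hxn, hxp⟩ := h.exists_pairing_eq_of_smul_mem hX hb
  obtain ⟨y, hy, hyn, hyp⟩ := h.exists_pairing_eq_of_smul_mem hX hc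
  refine ⟨x - y, X.sub_mem hx hy, (norm_sub_le _ _).trans (by linarith), fun z hz => ?_⟩
  simp [hxp z hz, hyp z hz]

/-- The projection on `X` along its annihilator in `E`. -/
theorem exists_projection (h : IsStateDuality j p S) {X : Submodule ℝ E}
    (hX : ∀ ω ∈ S, ∃ ωX, IsCondExpectation j (fun f e => p f e) S X ω ωX) :
    ∃ π : E →L[ℝ] E, (∀ a, π a ∈ X) ∧ (∀ a, ‖π a‖ ≤ ‖a‖) ∧
      ∀ a, ∀ y ∈ X, p (j (π a)) y = p (j a) y := by
  choose π hπX hπn hπ using h.exists_pairing_eq hX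
  -- Linearity of the chosen map comes from uniqueness in `X`.
  let L : E →ₗ[ℝ] E :=
    { toFun := π
      map_add' := fun a b => h.eq_of_mem (hπX _) (X.add_mem (hπX _) (hπX _)) fun y hy => by
        simp [hπ _ y hy]
      map_smul' := fun c a => h.eq_of_mem (hπX _) (X.smul_mem _ (hπX _)) fun y hy => by
        simp [hπ _ y hy] }
  exact ⟨L.mkContinuous 1 fun a => by simpa [L] using hπn a, hπX, hπn, hπ⟩

/-- The adjoint of a contraction of `E`. -/
theorem exists_adjoint (h : IsStateDuality j p S) (π : E →L[ℝ] E) (hπ : ∀ a, ‖π a‖ ≤ ‖a‖) :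
    ∃ π' : F →L[ℝ] F, (∀ f, ‖π' f‖ ≤ ‖f‖) ∧ ∀ f b, p (π' f) b = p f (π b) := by
  have hex : ∀ f, ∃ g, ∀ b, p g b = p f (π b) := fun f => by
    let φ : E →L[ℝ] ℝ := (p f).mkContinuous ‖f‖ (fun b => h.bound f b)
    exact h.surj (φ.comp π)
  choose π' hπ' using hex
  have hn : ∀ f, ‖π' f‖ ≤ ‖f‖ := fun f => h.norming _ _ (norm_nonneg _) fun b => by
    rw [hπ']
    exact (h.bound _ _).trans (mul_le_mul_of_nonneg_left (hπ b) (norm_nonneg _))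
  let L : F →ₗ[ℝ] F :=
    { toFun := π'
      map_add' := fun a b => h.ext_pairing fun y => by simp [hπ']
      map_smul' := fun c a => h.ext_pairing fun y => by simp [hπ'] }
  exact ⟨L.mkContinuous 1 fun a => by simpa [L] using hn a, hn, hπ'⟩

/-- On finitely many elements of `E`, every element of `F` acts like one of `E`. -/
theorem exists_pairing_eq_on_finset (h : IsStateDuality j p S) (f : F) (I : Finset E) :
    ∃ e, ∀ b ∈ I, p (j e) b = p f b := by
  classical
  let L : F →ₗ[ℝ] (I → ℝ) := LinearMap.pi fun b => p.flip b
  suffices hL : L f ∈ LinearMap.range (L ∘ₗ j) by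
    obtain ⟨e, he⟩ := hL
    exact ⟨e, fun b hb => congrFun he ⟨b, hb⟩⟩
  -- Otherwise a functional `g` on `ℝ^I` kills the image of `E` but not `L f`. On `F` it acts as
  -- pairing with a combination of the `b`, which pairs to zero with itself and so is zero.
  by_contra hL
  obtain ⟨g, hg, hgr⟩ := Submodule.exists_le_ker_of_notMem hL
  have key : ∀ f', g (L f') =
      p f' (∑ b : I, g (fun i => if b = i then 1 else 0) • (b : E)) := fun f' => by
    rw [LinearMap.pi_apply_eq_sum_univ g, map_sum]
    refine Finset.sum_congr rfl fun b _ => ?_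
    simp [L, mul_comm]
  have hz : ∑ b : I, g (fun i => if b = i then 1 else 0) • (b : E) = 0 := by
    refine h.definite _ ?_
    rw [← key]
    exact hgr ⟨_, rfl⟩
  refine hg ?_
  rw [key, hz, map_zero]

theorem exists_projections (h : IsStateDuality j p S) {X : Submodule ℝ E}
    (hX : ∀ ω ∈ S, ∃ ωX, IsCondExpectation j (fun f e => p f e) S X ω ωX) :
    ∃ (π₁ : E →L[ℝ] E) (π₂ : F →L[ℝ] F),
      IsProjectionAlong π₁ X (j ⁻¹' annihilator (fun f e => p f e) (X : Set E)) ∧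
      IsProjectionAlong π₂ (closure[weakStarTopology (fun f e => p f e)] (j '' X))
        (annihilator (fun f e => p f e) (X : Set E)) ∧
      (∀ a, π₂ (j a) = j (π₁ a)) ∧ (∀ a, ‖π₁ a‖ ≤ ‖a‖) ∧ (∀ a, ‖π₂ a‖ ≤ ‖a‖) ∧
      (∀ ω ∈ S, ∀ ωX, IsCondExpectation j (fun f e => p f e) S X ω ωX ↔ ωX = π₁ ω) := by
  obtain ⟨π₁, hX₁, hn₁, hp₁⟩ := h.exists_projection hX
  obtain ⟨π₂, hn₂, hp₂⟩ := h.exists_adjoint π₁ hn₁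
  have hfix : ∀ a ∈ X, π₁ a = a := fun a ha => h.eq_of_mem (hX₁ a) ha fun y hy => hp₁ a y hy
  have hsymm : ∀ a b, p (j (π₁ a)) b = p (j a) (π₁ b) := fun a b => by
    rw [h.symm, ← hp₁ b _ (hX₁ a), h.symm, hp₁ a _ (hX₁ b)]
  have hext : ∀ a, π₂ (j a) = j (π₁ a) := fun a => h.ext_pairing fun b => by rw [hp₂, hsymm]
  have hidem₂ : ∀ f, π₂ (π₂ f) = π₂ f := fun f => h.ext_pairing fun b => by
    rw [hp₂, hp₂, hp₂, hfix _ (hX₁ b)]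
  refine ⟨π₁, π₂, ⟨fun a => hfix _ (hX₁ a), ?_, ?_⟩, ⟨hidem₂, ?_, ?_⟩, hext, hn₁, hn₂, ?_⟩
  · ext x
    exact ⟨by rintro ⟨a, rfl⟩; exact hX₁ a, fun hx => ⟨x, hfix x hx⟩⟩
  · ext a
    refine ⟨fun ha y hy => ?_, fun ha => h.eq_of_mem (hX₁ a) X.zero_mem fun y hy => ?_⟩
    · have := hp₁ a y hy
      rw [show π₁ a = 0 from ha] at this
      simpa using this.symm
    · rw [hp₁ a y hy, map_zero, map_zero]
      exact ha y hy
  · ext f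
    constructor
    · rintro ⟨f, rfl⟩
      let _ := weakStarTopology (fun (f : F) (e : E) => p f e)
      rw [closure_induced, mem_closure_iff]
      intro o ho hfo
      obtain ⟨I, u, hu, huo⟩ := isOpen_pi_iff.1 ho _ hfo
      classical
      -- A basic neighbourhood of `π₂ f` tests finitely many `b`. If `e` agrees with `f` on the `π₁
      -- b`, then `π₁ e` agrees with `π₂ f` on the `b`.
      obtain ⟨e, he⟩ := h.exists_pairing_eq_on_finset f (I.image π₁)
      refine ⟨_, huo ?_, ⟨_, ⟨π₁ e, hX₁ e, rfl⟩, rfl⟩⟩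
      intro b hb
      have : p (j (π₁ e)) b = p (π₂ f) b := by
        rw [hsymm, he _ (Finset.mem_image_of_mem _ hb), hp₂]
      simp only [this]
      exact (hu b hb).2
    · intro hf
      refine ⟨f, h.ext_pairing fun b => ?_⟩
      rw [hp₂]
      let _ := weakStarTopology (fun (f : F) (e : E) => p f e)
      have hcont : ∀ b : E, Continuous fun f : F => p f b := fun b =>
        (continuous_apply b).comp continuous_induced_dom
      -- Being fixed by `π₂` is a weak-* closed condition when tested on each `b`, and it holds on
      -- `X`.
      have hcl : IsClosed {f : F | p f (π₁ b) = p f b} := isClosed_eq (hcont _) (hcont _)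
      refine closure_minimal ?_ hcl hf
      rintro _ ⟨x, hx, rfl⟩
      show p (j x) (π₁ b) = p (j x) b
      rw [← hsymm, hfix x hx]
  · ext f
    refine ⟨fun hf y hy => ?_, fun hf => h.ext_pairing fun b => ?_⟩
    · have := hp₂ f y
      rw [show π₂ f = 0 from hf, hfix y hy] at this
      simpa using this.symm
    · rw [hp₂, map_zero, LinearMap.zero_apply]
      exact hf _ (hX₁ b)
  · intro ω hω ωX
    constructor
    · rintro ⟨⟨hωX, -⟩, hω'⟩
      exact h.eq_of_mem hωX (hX₁ ω) fun y hy => (hω' y hy).trans (hp₁ ω y hy).symm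
    · rintro rfl
      obtain ⟨ωX, hωX⟩ := hX ω hω
      have : ωX = π₁ ω :=
        h.eq_of_mem hωX.1.1 (hX₁ ω) fun y hy => (hωX.2 y hy).trans (hp₁ ω y hy).symm
      exact this ▸ hωX

end IsStateDuality

/-- The states have spectral decompositions, and `ent` is the entropy of the eigenvalues. -/
structure HasSpectralEntropy.{u} (j : E →ₗ[ℝ] F) (p : F →ₗ[ℝ] E →ₗ[ℝ] ℝ) (S : Set E)
    (ent : E → ℝ≥0∞) : Prop where
  pairing_nonneg : ∀ ρ ∈ S, ∀ σ ∈ S, 0 ≤ p (j ρ) σ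
  spectral : ∀ ω ∈ S, ∃ (κ : Type u) (G : κ → E) (w : κ → ℝ), (∀ k, G k ∈ S) ∧ (∀ k, 0 ≤ w k) ∧
    (∀ k, w k ≤ 1) ∧ (∀ f, HasSum (fun k => w k * p f (G k)) (p f ω)) ∧
    (∀ ρ ∈ S, HasSum (fun k => p (j ρ) (G k)) 1) ∧ (∀ k, p (j (G k)) ω = w k) ∧
    ent ω = ∑' k, ENNReal.ofReal (Real.negMulLog (w k))

theorem IsStateDuality.entropy_le (h : IsStateDuality j p S) {ent : E → ℝ≥0∞}
    (he : HasSpectralEntropy j p S ent) {X : Submodule ℝ E}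
    (hX : ∀ ω ∈ S, ∃ ωX, IsCondExpectation j (fun f e => p f e) S X ω ωX) {ω : E} (hω : ω ∈ S)
    {ωX : E} (hωX : IsCondExpectation j (fun f e => p f e) S X ω ωX) : ent ω ≤ ent ωX := by
  obtain ⟨π, π', -, -, hext, -, -, hπ⟩ := h.exists_projections hX
  have hS : ∀ ρ ∈ S, π ρ ∈ S := fun ρ hρ => ((hπ ρ hρ _).2 rfl).1.2
  have hsymm : ∀ ρ ∈ S, ∀ σ ∈ S, p (j (π ρ)) σ = p (j ρ) (π σ) := fun ρ hρ σ hσ => by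
    have h1 := (hπ ρ hρ _).2 rfl
    have h2 := (hπ σ hσ _).2 rfl
    rw [h.symm]
    exact (h2.2 _ h1.1.1).symm.trans ((h.symm _ _).trans (h1.2 _ h2.1.1))
  obtain rfl := (hπ ω hω ωX).1 hωX
  obtain ⟨κ, G, w, hG, hw, hw1, hGω, hG1, -, hent⟩ := he.spectral ω hω
  obtain ⟨κ', G', m, hG', -, -, -, hG1', hm, hent'⟩ := he.spectral _ (hS ω hω)
  rw [hent, hent']
  -- Rows sum to 1 because `π (G' i)` is a state. For columns, symmetry moves `π` onto `G k`, again
  -- giving a state.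
  refine tsum_negMulLog_le_of_doublyStochastic (P := fun i k => p (j (π (G' i))) (G k))
    (fun i k => he.pairing_nonneg _ (hS _ (hG' i)) _ (hG k)) (fun i => hG1 _ (hS _ (hG' i)))
    (fun k => ?_) hw hw1 (fun i => ?_)
  · have := hG1' _ (hS _ (hG k))
    simpa only [hsymm _ (hG k) _ (hG' _), h.symm (G k)] using this
  · rw [← hm i, ← hsymm _ (hG' i) _ hω]
    exact hGω _

end Abstract

/-! ### Sequences form a state space -/

section SequenceStates

universe u

variable {ι : Type u}

theorem SeqL1.hasSum_abs (b : SeqL1 ι) : HasSum (fun i => |b i|) ‖b‖ := by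
  simpa using lp.hasSum_norm (p := 1) (by simp) b

theorem SeqLinf.abs_apply_le (a : SeqLinf ι) (i : ι) : |a i| ≤ ‖a‖ :=
  lp.norm_apply_le_norm ENNReal.top_ne_zero a i

theorem summable_abs_seqPairing (a : SeqLinf ι) (b : SeqL1 ι) :
    Summable fun i => |a i * b i| := by
  refine Summable.of_nonneg_of_le (fun _ => abs_nonneg _) (fun i => ?_)
    (b.hasSum_abs.summable.mul_left ‖a‖)
  rw [abs_mul]
  exact mul_le_mul_of_nonneg_right (a.abs_apply_le i) (abs_nonneg _)

theorem hasSum_seqPairing (a : SeqLinf ι) (b : SeqL1 ι) :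
    HasSum (fun i => a i * b i) (seqPairing a b) :=
  (summable_abs_seqPairing a b).of_abs.hasSum

theorem SeqL1.toLinf_apply (a : SeqL1 ι) (i : ι) : a.toLinf i = a i := rfl

/-- `SeqL1.toLinf` as a linear map. -/
def SeqL1.toLinfₗ : SeqL1 ι →ₗ[ℝ] SeqLinf ι where
  toFun := SeqL1.toLinf
  map_add' a b := by
    ext i
    simp only [lp.coeFn_add, Pi.add_apply, SeqL1.toLinf_apply]
  map_smul' c a := by
    ext i
    simp only [lp.coeFn_smul, Pi.smul_apply, SeqL1.toLinf_apply, RingHom.id_apply]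

theorem SeqL1.toLinfₗ_apply (b : SeqL1 ι) (i : ι) : SeqL1.toLinfₗ b i = b i := rfl

/-- `seqPairing` as a bilinear map. -/
def seqPairingₗ : SeqLinf ι →ₗ[ℝ] SeqL1 ι →ₗ[ℝ] ℝ :=
  LinearMap.mk₂ ℝ seqPairing
    (fun a a' b => (hasSum_seqPairing _ _).unique <| by
      simpa [add_mul] using (hasSum_seqPairing a b).add (hasSum_seqPairing a' b))
    (fun c a b => (hasSum_seqPairing _ _).unique <| by
      simpa [mul_assoc] using (hasSum_seqPairing a b).mul_left c)
    (fun a b b' => (hasSum_seqPairing _ _).unique <| by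
      simpa [mul_add] using (hasSum_seqPairing a b).add (hasSum_seqPairing a b'))
    (fun c a b => (hasSum_seqPairing _ _).unique <| by
      simpa [mul_left_comm] using (hasSum_seqPairing a b).mul_left c)

theorem hasSum_seqPairingₗ (a : SeqLinf ι) (b : SeqL1 ι) :
    HasSum (fun i => a i * b i) (seqPairingₗ a b) :=
  hasSum_seqPairing a b

theorem seqPairingₗ_single [DecidableEq ι] (a : SeqLinf ι) (i : ι) (c : ℝ) :
    seqPairingₗ a (lp.single 1 i c) = a i * c := by
  refine (hasSum_seqPairingₗ _ _).unique ?_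
  convert hasSum_single i fun k hk => ?_ using 1
  · simp
  · simp [hk]

theorem single_mem_seqStates [DecidableEq ι] (i : ι) :
    (lp.single 1 i (1 : ℝ) : SeqL1 ι) ∈ seqStates ι := by
  constructor
  · intro k
    rw [lp.single_apply, Pi.single_apply]
    split_ifs <;> simp
  · rw [tsum_eq_single i fun k hk => by simp [hk]]
    simp

theorem hasSum_of_mem_seqStates {ω : SeqL1 ι} (hω : ω ∈ seqStates ι) : HasSum (fun i => ω i) 1 := by
  have h : Summable fun i => ω i := ω.hasSum_abs.summable.of_abs
  rw [← hω.2]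
  exact h.hasSum

theorem SeqL1.eq_zero_or_inv_norm_smul_mem {b : SeqL1 ι} (hb : ∀ i, 0 ≤ b i) :
    b = 0 ∨ ‖b‖⁻¹ • b ∈ seqStates ι := by
  by_cases h : b = 0
  · exact Or.inl h
  refine Or.inr ⟨fun i => mul_nonneg (inv_nonneg.2 (norm_nonneg b)) (hb i), ?_⟩
  have hs := b.hasSum_abs.mul_left ‖b‖⁻¹
  rw [inv_mul_cancel₀ (norm_ne_zero_iff.2 h)] at hs
  rw [← hs.tsum_eq]
  exact tsum_congr fun i => by simp [abs_of_nonneg (hb i)]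

theorem SeqL1.exists_eq_sub_of_nonneg (a : SeqL1 ι) :
    ∃ b c : SeqL1 ι, a = b - c ∧ ‖b‖ + ‖c‖ ≤ ‖a‖ ∧ (∀ i, 0 ≤ b i) ∧ ∀ i, 0 ≤ c i := by
  have hmem : ∀ f : ι → ℝ, (∀ i, |f i| ≤ |a i|) → Memℓp f 1 := fun f hf => by
    refine memℓp_gen ?_
    simpa using Summable.of_nonneg_of_le (fun _ => abs_nonneg _) hf a.hasSum_abs.summable
  let b : SeqL1 ι := ⟨fun i => (a i)⁺, hmem _ fun i => by
    rw [abs_of_nonneg (posPart_nonneg _), ← posPart_add_negPart]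
    linarith [negPart_nonneg (a i)]⟩
  let c : SeqL1 ι := ⟨fun i => (a i)⁻, hmem _ fun i => by
    rw [abs_of_nonneg (negPart_nonneg _), ← posPart_add_negPart]
    linarith [posPart_nonneg (a i)]⟩
  have hb : ∀ i, b i = (a i)⁺ := fun _ => rfl
  have hc : ∀ i, c i = (a i)⁻ := fun _ => rfl
  refine ⟨b, c, ?_, ?_, fun i => posPart_nonneg _, fun i => negPart_nonneg _⟩
  · ext i
    rw [lp.coeFn_sub, Pi.sub_apply, hb, hc, posPart_sub_negPart]
  · refine le_of_eq ((b.hasSum_abs.add c.hasSum_abs).unique ?_)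
    convert a.hasSum_abs using 2 with i
    rw [hb, hc, abs_of_nonneg (posPart_nonneg _), abs_of_nonneg (negPart_nonneg _),
      posPart_add_negPart]

variable (ι) in
theorem isStateDuality_seq :
    IsStateDuality (SeqL1.toLinfₗ (ι := ι)) seqPairingₗ (seqStates ι) where
  symm a b := (hasSum_seqPairingₗ _ _).unique <| by
    simpa only [SeqL1.toLinfₗ_apply, mul_comm] using hasSum_seqPairingₗ (SeqL1.toLinfₗ b) a
  definite a ha := by
    have h := hasSum_seqPairingₗ (SeqL1.toLinfₗ a) a
    rw [ha] at h
    have h2 := (hasSum_zero_iff_of_nonneg fun i => mul_self_nonneg (a i)).1 h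
    ext i
    exact mul_self_eq_zero.1 (congrFun h2 i)
  bound a b := by
    have h := summable_abs_seqPairing a b
    calc |seqPairingₗ a b| ≤ ∑' i, |a i * b i| := by
          rw [← (hasSum_seqPairingₗ a b).tsum_eq]
          simpa only [Real.norm_eq_abs] using norm_tsum_le_tsum_norm (f := fun i => a i * b i) h
      _ ≤ ∑' i, ‖a‖ * |b i| := by
          refine h.tsum_le_tsum (fun i => ?_) (b.hasSum_abs.summable.mul_left _)
          rw [abs_mul]
          exact mul_le_mul_of_nonneg_right (a.abs_apply_le i) (abs_nonneg _)
      _ = _ := (b.hasSum_abs.mul_left _).tsum_eq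
  norming f C hC h := by
    classical
    refine lp.norm_le_of_forall_le hC fun i => ?_
    have := h (lp.single 1 i 1)
    rw [seqPairingₗ_single, lp.norm_single (by simp)] at this
    simpa using this
  surj φ := by
    classical
    have hbd : ∀ i, ‖φ (lp.single 1 i 1)‖ ≤ ‖φ‖ := fun i => by
      have := φ.le_opNorm (lp.single 1 i 1)
      rwa [lp.norm_single (by simp), norm_one, mul_one] at this
    refine ⟨⟨fun i => φ (lp.single 1 i 1), memℓp_infty ⟨‖φ‖, ?_⟩⟩, fun b => ?_⟩
    · rintro _ ⟨i, rfl⟩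
      exact hbd i
    · refine (hasSum_seqPairingₗ _ _).unique ?_
      -- The expansion of `b` in unit vectors converges in `ℓ₁`, so `φ` is determined by its values
      -- on them.
      have h := (lp.hasSum_single ENNReal.one_ne_top b).mapL φ
      convert h using 2 with i
      have : lp.single 1 i (b i) = b i • (lp.single 1 i (1 : ℝ) : SeqL1 ι) := by
        rw [← lp.single_smul, smul_eq_mul, mul_one]
      rw [this, map_smul, smul_eq_mul, mul_comm]
  norm_state ω hω := by
    refine le_of_eq (ω.hasSum_abs.unique ?_)
    simpa only [abs_of_nonneg (hω.1 _)] using hasSum_of_mem_seqStates hω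
  decomp a := by
    obtain ⟨b, c, h, hn, hb, hc⟩ := a.exists_eq_sub_of_nonneg
    exact ⟨b, c, h, hn, SeqL1.eq_zero_or_inv_norm_smul_mem hb,
      SeqL1.eq_zero_or_inv_norm_smul_mem hc⟩

variable (ι) in
theorem hasSpectralEntropy_seq :
    HasSpectralEntropy.{u, u, u} (SeqL1.toLinfₗ (ι := ι)) seqPairingₗ (seqStates ι) seqEntropy where
  pairing_nonneg ρ hρ σ hσ :=
    (hasSum_seqPairingₗ _ _).nonneg fun i => mul_nonneg (hρ.1 i) (hσ.1 i)
  spectral ω hω := by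
    classical
    refine ⟨ι, fun i => lp.single 1 i 1, fun i => ω i, single_mem_seqStates, hω.1, fun i => ?_,
      fun f => ?_, fun ρ hρ => ?_, fun i => ?_, rfl⟩
    · exact le_hasSum (hasSum_of_mem_seqStates hω) i fun k _ => hω.1 k
    · simpa only [seqPairingₗ_single, mul_one, mul_comm (ω _)] using hasSum_seqPairingₗ f ω
    · simpa only [seqPairingₗ_single, mul_one, SeqL1.toLinfₗ_apply] using hasSum_of_mem_seqStates hρ
    · rw [(isStateDuality_seq ι).symm, seqPairingₗ_single, mul_one, SeqL1.toLinfₗ_apply]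

end SequenceStates

/-! ### Diagonalization of trace-class operators -/

section Diagonalization

universe u

variable {H : Type u} [NormedAddCommGroup H] [InnerProductSpace ℂ H]

theorem hasSum_norm_sq_inner {κ : Type*} (f : HilbertBasis κ ℂ H) (x : H) :
    HasSum (fun k => ‖⟪f k, x⟫_ℂ‖ ^ 2) (‖x‖ ^ 2) := by
  have h := (f.hasSum_inner_mul_inner x x).mapL (RCLike.reCLM (K := ℂ))
  have h4 : RCLike.reCLM (K := ℂ) ⟪x, x⟫_ℂ = ‖x‖ ^ 2 := by
    rw [RCLike.reCLM_apply, inner_self_eq_norm_sq]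
  rw [h4] at h
  have h3 : (fun k => RCLike.reCLM (K := ℂ) (⟪x, f k⟫_ℂ * ⟪f k, x⟫_ℂ)) =
      fun k => ‖⟪f k, x⟫_ℂ‖ ^ 2 := by
    funext k
    rw [← inner_conj_symm x (f k), RCLike.conj_mul, RCLike.reCLM_apply]
    norm_cast
  rw [h3] at h
  exact h

theorem HilbertBasis.ext_inner {κ : Type*} (f : HilbertBasis κ ℂ H) {x y : H}
    (h : ∀ k, ⟪f k, x⟫_ℂ = ⟪f k, y⟫_ℂ) : x = y := by
  rw [← sub_eq_zero, ← norm_eq_zero, ← sq_eq_zero_iff]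
  refine (hasSum_norm_sq_inner f (x - y)).unique ?_
  simp [h]

/-- The finite sum is `S` followed by the projection on the span of the `e i`, `i ∈ s`. Only the
coordinates `⟪S (e k), y⟫` with `k ∉ s` remain, and Cauchy-Schwarz bounds them by a Hilbert-Schmidt
tail. -/
theorem norm_sub_sum_rankOne_apply_le {κ : Type*} (e : HilbertBasis κ ℂ H) {S : H →L[ℂ] H}
    (hS : ∀ x y : H, ⟪S x, y⟫_ℂ = ⟪x, S y⟫_ℂ)
    (h : ∑' i, ENNReal.ofReal (‖S (e i)‖ ^ 2) ≠ ∞) (s : Finset κ) (y : H) :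
    ‖(S - ∑ i ∈ s, InnerProductSpace.rankOne ℂ (e i) (S (e i))) y‖ ^ 2 ≤
      (∑' i : {i // i ∉ s}, ENNReal.ofReal (‖S (e i)‖ ^ 2)).toReal * ‖y‖ ^ 2 := by
  classical
  set D := S - ∑ i ∈ s, InnerProductSpace.rankOne ℂ (e i) (S (e i)) with hD
  have hin : ∀ k, ⟪e k, D y⟫_ℂ = if k ∈ s then 0 else ⟪S (e k), y⟫_ℂ := by
    intro k
    have h1 : ⟪e k, D y⟫_ℂ = ⟪S (e k), y⟫_ℂ - ∑ i ∈ s, ⟪S (e i), y⟫_ℂ * ⟪e k, e i⟫_ℂ := by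
      simp [hD, sum_apply, hS]
    rw [h1]
    simp_rw [orthonormal_iff_ite.1 e.orthonormal]
    split_ifs with hk <;> simp [hk]
  have hfin : ∑' i : {i // i ∉ s}, ENNReal.ofReal (‖S (e i)‖ ^ 2) ≠ ∞ :=
    ne_top_of_le_ne_top h (ENNReal.tsum_comp_le_tsum_of_injective Subtype.val_injective _)
  rw [← ENNReal.ofReal_le_ofReal_iff (by positivity), ENNReal.ofReal_mul ENNReal.toReal_nonneg,
    ENNReal.ofReal_toReal hfin, ofReal_norm_sq_eq_tsum e, ← ENNReal.tsum_mul_right]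
  have := tsum_subtype {i | i ∉ s}
    fun i => ENNReal.ofReal (‖S (e i)‖ ^ 2) * ENNReal.ofReal (‖y‖ ^ 2)
  refine le_trans ?_ this.ge
  refine ENNReal.tsum_le_tsum fun k => ?_
  rw [hin]
  split_ifs with hk
  · simp
  · rw [Set.indicator_of_mem (by exact hk), ← ENNReal.ofReal_mul (by positivity), ← mul_pow]
    gcongr
    exact norm_inner_le_norm _ _

variable [CompleteSpace H]

omit [CompleteSpace H] in
theorem isCompactOperator_rankOne (x y : H) :
    IsCompactOperator (InnerProductSpace.rankOne ℂ x y) := by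
  rw [InnerProductSpace.rankOne_def']
  exact (isCompactOperator_of_locallyCompactSpace_rng
    (ContinuousLinearMap.toSpanSingleton ℂ x)).comp_clm (innerSL ℂ y)

/-- A Hilbert-Schmidt operator is compact. -/
theorem isCompactOperator_of_tsum_norm_sq {κ : Type*} (e : HilbertBasis κ ℂ H) {S : H →L[ℂ] H}
    (hS : ∀ x y : H, ⟪S x, y⟫_ℂ = ⟪x, S y⟫_ℂ)
    (h : ∑' i, ENNReal.ofReal (‖S (e i)‖ ^ 2) ≠ ∞) : IsCompactOperator S := by
  let G : Finset κ → H →L[ℂ] H := fun s => ∑ i ∈ s, InnerProductSpace.rankOne ℂ (e i) (S (e i))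
  have hG : Filter.Tendsto G Filter.atTop (𝓝 S) := by
    rw [tendsto_iff_norm_sub_tendsto_zero]
    have hr := (ENNReal.tendsto_toReal ENNReal.zero_ne_top).comp
      (ENNReal.tendsto_tsum_compl_atTop_zero h)
    have hr2 := (Real.continuous_sqrt.tendsto _).comp hr
    simp only [ENNReal.toReal_zero, Real.sqrt_zero] at hr2
    refine squeeze_zero (fun _ => norm_nonneg _) (fun s => ?_) hr2
    rw [norm_sub_rev]
    refine ContinuousLinearMap.opNorm_le_bound _ (Real.sqrt_nonneg _) fun y => ?_
    refine (abs_le_of_sq_le_sq' ?_ (mul_nonneg (Real.sqrt_nonneg _) (norm_nonneg _))).2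
    rw [mul_pow]
    simp only [Function.comp]
    rw [Real.sq_sqrt ENNReal.toReal_nonneg]
    exact norm_sub_sum_rankOne_apply_le e hS h s y
  refine isCompactOperator_of_tendsto hG (Filter.Eventually.of_forall fun s => ?_)
  exact Submodule.sum_mem (compactOperator (RingHom.id ℂ) H H)
    fun i _ => isCompactOperator_rankOne _ _

omit [CompleteSpace H] in
theorem re_inner_nonneg {T : H →L[ℂ] H} (hT : 0 ≤ T) (x : H) : 0 ≤ RCLike.re ⟪x, T x⟫_ℂ :=
  ((ContinuousLinearMap.nonneg_iff_isPositive _).1 hT).re_inner_nonneg_right x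

/-- As `⟪e i, T (e i)⟫ = ‖√T (e i)‖ ^ 2`, the square root of `T` is Hilbert-Schmidt, hence compact.
-/
theorem isCompactOperator_of_diagSum {κ : Type*} (e : HilbertBasis κ ℂ H) {T : H →L[ℂ] H}
    (hT : 0 ≤ T) (h : diagSum e T ≠ ∞) : IsCompactOperator T := by
  have hS : IsSelfAdjoint (CFC.sqrt T) := (CFC.sqrt_nonneg T).isSelfAdjoint
  have hSS : CFC.sqrt T * CFC.sqrt T = T := CFC.sqrt_mul_sqrt_self T hT
  have hsym : ∀ x y : H, ⟪CFC.sqrt T x, y⟫_ℂ = ⟪x, CFC.sqrt T y⟫_ℂ := hS.isSymmetric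
  have hc : IsCompactOperator (CFC.sqrt T : H →L[ℂ] H) := by
    refine isCompactOperator_of_tsum_norm_sq e hsym ?_
    convert h using 1
    refine tsum_congr fun i => ?_
    conv_rhs => rw [← hSS, mul_apply_eq_comp, ← hsym, inner_self_eq_norm_sq]
  rw [← hSS]
  exact hc.clm_comp _

theorem diagSum_mono {κ : Type*} (e : HilbertBasis κ ℂ H) {A B : H →L[ℂ] H} (h : A ≤ B) :
    diagSum e A ≤ diagSum e B := by
  refine ENNReal.tsum_le_tsum fun i => ENNReal.ofReal_le_ofReal ?_
  have := re_inner_nonneg (sub_nonneg.2 h) (e i)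
  simpa [inner_sub_right] using this

theorem isCompactOperator_of_traceNorm {T : H →L[ℂ] H} (hT : IsSelfAdjoint T)
    (h : traceNorm T < ∞) : IsCompactOperator T := by
  have hsum := CFC.posPart_add_negPart T hT
  have hp0 := CFC.posPart_nonneg T
  have hn0 := CFC.negPart_nonneg T
  have hp := isCompactOperator_of_diagSum (onb H) hp0
    ((diagSum_mono _ (hsum ▸ le_add_of_nonneg_right hn0)).trans_lt h).ne
  have hn := isCompactOperator_of_diagSum (onb H) hn0
    ((diagSum_mono _ (hsum ▸ le_add_of_nonneg_left hp0)).trans_lt h).ne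
  rw [← CFC.posPart_sub_negPart T hT]
  exact hp.sub hn

/-- `g` is an orthonormal basis of eigenvectors of `T`, with eigenvalues `μ`. -/
def IsEigenbasis {κ : Type*} (T : H →L[ℂ] H) (g : HilbertBasis κ ℂ H) (μ : κ → ℝ) : Prop :=
  ∀ k, T (g k) = (μ k : ℂ) • g k

/-- Orthonormal bases of all eigenspaces, the kernel included, are glued together; the spectral
theorem for compact operators makes the union complete. -/
theorem exists_isEigenbasis {T : H →L[ℂ] H} (hT : IsSelfAdjoint T) (hc : IsCompactOperator T) :
    ∃ (κ : Type u) (g : HilbertBasis κ ℂ H) (μ : κ → ℝ), IsEigenbasis T g μ := by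
  have hsym : T.toLinearMap.IsSymmetric := hT.isSymmetric
  have hbot := ContinuousLinearMap.orthogonalComplement_iSup_eigenspaces_eq_bot hc hsym
  have hcl : ∀ z, CompleteSpace (Module.End.eigenspace T.toLinearMap z) := fun z => by
    have : IsClosed (Module.End.eigenspace T.toLinearMap z : Set H) := by
      have : (Module.End.eigenspace T.toLinearMap z : Set H) = {x | T x = z • x} := by
        ext x; exact Module.End.mem_eigenspace_iff
      rw [this]
      exact isClosed_eq T.continuous (continuous_const_smul z)
    exact this.completeSpace_coe
  choose w b hb using fun z : ℂ =>
    exists_hilbertBasis ℂ (Module.End.eigenspace T.toLinearMap z)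
  have horth := hsym.orthogonalFamily_eigenspaces.orthonormal_sigma_orthonormal
    fun z => (b z).orthonormal
  refine ⟨(z : ℂ) × w z, HilbertBasis.mkOfOrthogonalEqBot horth ?_, fun a => a.1.re, fun a => ?_⟩
  · rw [Submodule.eq_bot_iff] at hbot ⊢
    intro x hx
    refine hbot x ?_
    rw [← Submodule.iInf_orthogonal, Submodule.mem_iInf]
    intro z y hy
    -- A vector orthogonal to the basis of an eigenspace has zero projection on it, so it is
    -- orthogonal to the whole eigenspace.
    have h0 : ∀ k, ⟪b z k, (Module.End.eigenspace T.toLinearMap z).orthogonalProjectionOnto x⟫_ℂ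
        = 0 := fun k => by
      rw [Submodule.inner_orthogonalProjectionOnto_eq_of_mem_left]
      exact hx _ (Submodule.subset_span ⟨⟨z, k⟩, rfl⟩)
    have h1 : (Module.End.eigenspace T.toLinearMap z).orthogonalProjectionOnto x = 0 :=
      (b z).ext_inner fun k => by rw [h0, inner_zero_right]
    have := Submodule.inner_orthogonalProjectionOnto_eq_of_mem_left (⟨y, hy⟩ :
      Module.End.eigenspace T.toLinearMap z) x
    rw [h1, inner_zero_right] at this
    exact this.symm
  · obtain ⟨z, k⟩ := a
    rw [HilbertBasis.coe_mkOfOrthogonalEqBot]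
    have hmem : T (b z k : H) = z • (b z k : H) := Module.End.mem_eigenspace_iff.1 (b z k).2
    have hne : (b z k : H) ≠ 0 := fun h0 =>
      (b z).orthonormal.ne_zero k (Subtype.ext h0)
    have hz : (starRingEnd ℂ) z = z :=
      hsym.conj_eigenvalue_eq_self
        (Module.End.hasEigenvalue_of_hasEigenvector ⟨(b z k).2, hne⟩)
    show T (b z k : H) = ((z.re : ℝ) : ℂ) • (b z k : H)
    rw [hmem, Complex.conj_eq_iff_re.1 hz]

namespace IsEigenbasis

variable {κ : Type*} {T : H →L[ℂ] H} {g : HilbertBasis κ ℂ H} {μ : κ → ℝ}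

omit [CompleteSpace H] in
theorem re_inner (h : IsEigenbasis T g μ) (k : κ) : RCLike.re ⟪g k, T (g k)⟫_ℂ = μ k := by
  rw [h k, inner_smul_right, inner_self_eq_norm_sq_to_K, g.orthonormal.1]
  simp

theorem inner_apply (h : IsEigenbasis T g μ) (hT : IsSelfAdjoint T) (k : κ) (x : H) :
    ⟪g k, T x⟫_ℂ = μ k * ⟪g k, x⟫_ℂ := by
  have hsym : ⟪T (g k), x⟫_ℂ = ⟪g k, T x⟫_ℂ := hT.isSymmetric _ _
  rw [← hsym, h k, inner_smul_left, Complex.conj_ofReal]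

/-- From `|T|² g_k = μ_k² g_k`, the vector `y = |T| g_k - |μ_k| g_k` satisfies `|T| y = -|μ_k| y`.
Positivity of `|T|` forces `y = 0` when `μ_k ≠ 0`; for `μ_k = 0`, `‖|T| g_k‖² = 0`. -/
protected theorem abs (h : IsEigenbasis T g μ) (hT : IsSelfAdjoint T) :
    IsEigenbasis (CFC.abs T) g fun k => |μ k| := by
  intro k
  have hsym : ∀ x y : H, ⟪CFC.abs T x, y⟫_ℂ = ⟪x, CFC.abs T y⟫_ℂ :=
    (CFC.abs_nonneg T).isSelfAdjoint.isSymmetric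
  have hsq : CFC.abs T (CFC.abs T (g k)) = ((|μ k| : ℝ) : ℂ) • ((|μ k| : ℝ) : ℂ) • g k := by
    have : (CFC.abs T * CFC.abs T) (g k) = (star T * T) (g k) := by rw [CFC.abs_mul_abs]
    rw [mul_apply_eq_comp, mul_apply_eq_comp, hT.star_eq, h k, map_smul, h k] at this
    rw [this, smul_smul, smul_smul, ← Complex.ofReal_mul, ← Complex.ofReal_mul, abs_mul_abs_self]
  rcases eq_or_ne (μ k) 0 with h0 | h0
  · rw [h0] at hsq
    have : ⟪CFC.abs T (g k), CFC.abs T (g k)⟫_ℂ = 0 := by rw [hsym, hsq]; simp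
    simpa [h0] using this
  · set y := CFC.abs T (g k) - ((|μ k| : ℝ) : ℂ) • g k with hy
    have h1 : CFC.abs T y = -(((|μ k| : ℝ) : ℂ) • y) := by
      rw [hy, map_sub, hsq, map_smul, smul_sub, neg_sub]
    have h2 := re_inner_nonneg (CFC.abs_nonneg T) y
    have h5 : RCLike.re (((|μ k| : ℝ) : ℂ) * ⟪y, y⟫_ℂ) = |μ k| * RCLike.re ⟪y, y⟫_ℂ :=
      Complex.re_ofReal_mul _ _
    rw [h1, inner_neg_right, inner_smul_right, map_neg, h5, inner_self_eq_norm_sq] at h2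
    have h3 : 0 < |μ k| := abs_pos.2 h0
    have h4 : ‖y‖ ^ 2 = 0 := by nlinarith [sq_nonneg ‖y‖]
    exact sub_eq_zero.1 (norm_eq_zero.1 (pow_eq_zero_iff two_ne_zero |>.1 h4))

theorem traceNorm_eq_tsum (h : IsEigenbasis T g μ) (hT : IsSelfAdjoint T) :
    traceNorm T = ∑' k, ENNReal.ofReal |μ k| := by
  rw [traceNorm_eq g]
  exact tsum_congr fun k => by rw [(h.abs hT).re_inner]

/-- The trace of `a T`, computed in any orthonormal basis, is `∑ μ_k ⟨g_k, a g_k⟩`. -/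
theorem hasSum_inner_mul (h : IsEigenbasis T g μ) (hT : IsSelfAdjoint T)
    (hμ : Summable fun k => |μ k|) (a : H →L[ℂ] H) {κ' : Type*} (e : HilbertBasis κ' ℂ H) :
    ∃ s, HasSum (fun k => (μ k : ℂ) * ⟪g k, a (g k)⟫_ℂ) s ∧
      HasSum (fun i => ⟪e i, a (T (e i))⟫_ℂ) s := by
  -- Parseval in either variable turns this double family into one of the two sums, so absolute
  -- summability suffices. It follows from `2|uv| ≤ |u|² + |v|²` and summability of `|μ k|`.
  let F : κ × κ' → ℂ := fun q =>
    (μ q.1 : ℂ) * (⟪g q.1, e q.2⟫_ℂ * ⟪e q.2, a (g q.1)⟫_ℂ)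
  have hF : Summable F := by
    have hfib : ∀ k, HasSum (fun i => |μ k| * (‖⟪e i, g k⟫_ℂ‖ ^ 2 + ‖⟪e i, a (g k)⟫_ℂ‖ ^ 2))
        (|μ k| * (‖g k‖ ^ 2 + ‖a (g k)‖ ^ 2)) := fun k =>
      ((hasSum_norm_sq_inner e _).add (hasSum_norm_sq_inner e _)).mul_left _
    have hB : Summable fun q : κ × κ' =>
        |μ q.1| * (‖⟪e q.2, g q.1⟫_ℂ‖ ^ 2 + ‖⟪e q.2, a (g q.1)⟫_ℂ‖ ^ 2) := by
      rw [summable_prod_of_nonneg fun q => by positivity]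
      refine ⟨fun k => (hfib k).summable, ?_⟩
      simp only [(hfib _).tsum_eq]
      refine Summable.of_nonneg_of_le (fun _ => by positivity) (fun k => ?_)
        (hμ.mul_right (1 + ‖a‖ ^ 2))
      have : ‖a (g k)‖ ≤ ‖a‖ := by
        simpa [g.orthonormal.1 k] using a.le_opNorm (g k)
      rw [g.orthonormal.1 k, one_pow]
      gcongr
    refine Summable.of_norm_bounded hB fun q => ?_
    simp only [F, norm_mul, Complex.norm_real, Real.norm_eq_abs]
    rw [norm_inner_symm (g q.1)]
    gcongr
    nlinarith [sq_nonneg (‖⟪e q.2, g q.1⟫_ℂ‖ - ‖⟪e q.2, a (g q.1)⟫_ℂ‖),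
      sq_nonneg (‖⟪e q.2, g q.1⟫_ℂ‖), sq_nonneg (‖⟪e q.2, a (g q.1)⟫_ℂ‖)]
  refine ⟨_, hF.hasSum.prod_fiberwise fun k => (e.hasSum_inner_mul_inner _ _).mul_left _, ?_⟩
  refine HasSum.prod_fiberwise (f := fun q : κ' × κ => F q.swap) ?_ fun i => ?_
  · exact (Equiv.prodComm κ' κ).hasSum_iff.2 hF.hasSum
  · have h1 := g.hasSum_inner_mul_inner (a.adjoint (e i)) (T (e i))
    rw [ContinuousLinearMap.adjoint_inner_left] at h1
    have h2 : ∀ k, F (k, i) = ⟪a.adjoint (e i), g k⟫_ℂ * ⟪g k, T (e i)⟫_ℂ := fun k => ?_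
    · simpa only [h2, Prod.swap] using h1
    rw [ContinuousLinearMap.adjoint_inner_left, h.inner_apply hT]
    simp only [F]
    ring

theorem finite_setOf_eq (hμ : Summable fun k => |μ k|) {t : ℝ} (ht : t ≠ 0) :
    {k | μ k = t}.Finite := by
  have h := hμ.tendsto_cofinite_zero.eventually (gt_mem_nhds (abs_pos.2 ht))
  rw [Filter.eventually_cofinite] at h
  refine h.subset fun k hk => ?_
  rw [Set.mem_ofPred_eq] at hk ⊢
  rw [hk]
  exact lt_irrefl _

/-- An eigenvector for `t` has zero coordinate at every `k` with `μ k ≠ t`. For `t ≠ 0` only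
finitely many `k` remain; the kernel may be infinite-dimensional, where `finrank` is 0. -/
theorem finrank_eigenspace (h : IsEigenbasis T g μ) (hT : IsSelfAdjoint T)
    (hμ : Summable fun k => |μ k|) {t : ℝ} (ht : t ≠ 0) :
    ((Module.finrank ℂ (Module.End.eigenspace T.toLinearMap (t : ℂ)) : ℕ) : ℕ∞) =
      {k | μ k = t}.encard := by
  have hfin := finite_setOf_eq hμ ht
  have : Fintype {k | μ k = t} := hfin.fintype
  have hspan : Module.End.eigenspace T.toLinearMap (t : ℂ) =
      Submodule.span ℂ (Set.range fun k : {k | μ k = t} => g k) := by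
    refine le_antisymm (fun x hx => ?_) ?_
    · have hx' : T x = (t : ℂ) • x := Module.End.mem_eigenspace_iff.1 hx
      have hz : ∀ k, k ∉ hfin.toFinset → g.repr x k • g k = 0 := fun k hk => by
        have h1 := h.inner_apply hT k x
        rw [hx', inner_smul_right] at h1
        have h2 : ((t : ℂ) - μ k) * ⟪g k, x⟫_ℂ = 0 := by rw [sub_mul, h1, sub_self]
        rcases mul_eq_zero.1 h2 with h2 | h2
        · exfalso
          refine hk (hfin.mem_toFinset.2 ?_)
          rw [sub_eq_zero] at h2
          exact (Complex.ofReal_injective h2).symm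
        · rw [g.repr_apply_apply, h2, zero_smul]
      rw [(g.hasSum_repr x).unique (hasSum_sum_of_ne_finset_zero hz)]
      refine Submodule.sum_mem _ fun k hk => Submodule.smul_mem _ _ (Submodule.subset_span ?_)
      exact ⟨⟨k, hfin.mem_toFinset.1 hk⟩, rfl⟩
    · rw [Submodule.span_le]
      rintro _ ⟨⟨k, hk⟩, rfl⟩
      refine Module.End.mem_eigenspace_iff.2 ?_
      have := h k
      rw [Set.mem_ofPred_eq] at hk
      rwa [hk] at this
  have hli : LinearIndependent ℂ fun k : {k | μ k = t} => g k :=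
    g.orthonormal.linearIndependent.comp _ Subtype.val_injective
  rw [hspan, finrank_span_eq_card hli, Set.encard, ENat.card_eq_coe_fintype_card]

/-- This converts the sum over eigenvalues in `opEntropy` into a sum over the eigenbasis. The
condition `f 0 = 0` makes the multiplicity of the eigenvalue 0 irrelevant. -/
theorem tsum_finrank_mul (h : IsEigenbasis T g μ) (hT : IsSelfAdjoint T)
    (hμ : Summable fun k => |μ k|) {f : ℝ → ℝ≥0∞} (hf : f 0 = 0) :
    ∑' t : ℝ, (Module.finrank ℂ (Module.End.eigenspace T.toLinearMap (t : ℂ)) : ℝ≥0∞) * f t =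
      ∑' k, f (μ k) := by
  rw [← ENNReal.tsum_fiberwise (fun k => f (μ k)) μ]
  refine tsum_congr fun t => ?_
  have hfib : ∑' b : μ ⁻¹' {t}, f (μ b) = ∑' _ : μ ⁻¹' {t}, f t :=
    tsum_congr fun b => by rw [show μ b = t from b.2]
  rw [hfib, ENNReal.tsum_set_const]
  rcases eq_or_ne t 0 with rfl | ht
  · rw [hf, mul_zero, mul_zero]
  · rw [show μ ⁻¹' {t} = {k | μ k = t} from rfl, ← h.finrank_eigenspace hT hμ ht]
    rfl

end IsEigenbasis

end Diagonalization

/-! ### Trace and trace norm of Hermitian trace-class operators -/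

section HermitianTraceClass

universe u

variable {H : Type u} [NormedAddCommGroup H] [InnerProductSpace ℂ H] [CompleteSpace H]

namespace HermTraceClass

/-- The underlying operator. -/
abbrev op (b : HermTraceClass H) : H →L[ℂ] H := b.toBounded

theorem isSelfAdjoint_op (b : HermTraceClass H) : IsSelfAdjoint b.op := b.toBounded.2

theorem traceNorm_lt_top (b : HermTraceClass H) : traceNorm b.op < ∞ :=
  (show hermTraceClass H from b).2

/-- A Hermitian operator with finite trace norm. -/
def mk (T : H →L[ℂ] H) (hT : IsSelfAdjoint T) (h : traceNorm T < ∞) : HermTraceClass H :=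
  (⟨⟨T, hT⟩, h⟩ : hermTraceClass H)

theorem op_mk {T : H →L[ℂ] H} (hT : IsSelfAdjoint T) (h : traceNorm T < ∞) :
    (mk T hT h).op = T := rfl

theorem op_injective : Function.Injective (op : HermTraceClass H → H →L[ℂ] H) := fun _ _ h =>
  Subtype.ext (Subtype.ext h)

variable (H) in
/-- `HermTraceClass.toBounded` as a linear map. -/
def toBoundedₗ : HermTraceClass H →ₗ[ℝ] HermBounded H := (hermTraceClass H).subtype

variable (H) in
/-- `HermTraceClass.op` as a linear map. -/
def opₗ : HermTraceClass H →ₗ[ℝ] H →L[ℂ] H :=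
  (selfAdjoint.submodule ℝ (H →L[ℂ] H)).subtype ∘ₗ toBoundedₗ H

theorem op_add (a b : HermTraceClass H) : (a + b).op = a.op + b.op := map_add (opₗ H) a b

theorem op_sub (a b : HermTraceClass H) : (a - b).op = a.op - b.op := map_sub (opₗ H) a b

theorem op_smul (c : ℝ) (a : HermTraceClass H) : (c • a).op = c • a.op := map_smul (opₗ H) c a

theorem op_sum {κ : Type*} (s : Finset κ) (a : κ → HermTraceClass H) :
    (∑ k ∈ s, a k).op = ∑ k ∈ s, (a k).op := map_sum (opₗ H) a s

theorem norm_def (a : HermTraceClass H) : ‖a‖ = (traceNorm a.op).toReal := rfl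

theorem hasSum_abs_eigenvalues {κ : Type*} {g : HilbertBasis κ ℂ H} {μ : κ → ℝ}
    {b : HermTraceClass H} (h : IsEigenbasis b.op g μ) : HasSum (fun k => |μ k|) ‖b‖ := by
  have h1 := h.traceNorm_eq_tsum b.isSelfAdjoint_op
  have h2 : ∑' k, ENNReal.ofReal |μ k| ≠ ∞ := h1 ▸ b.traceNorm_lt_top.ne
  have h3 := ENNReal.hasSum_toReal h2
  rw [← ENNReal.tsum_toReal_eq fun _ => ENNReal.ofReal_ne_top, ← h1, ← norm_def] at h3
  simpa only [ENNReal.toReal_ofReal (abs_nonneg _)] using h3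

theorem exists_eigenbasis (b : HermTraceClass H) :
    ∃ (κ : Type u) (g : HilbertBasis κ ℂ H) (μ : κ → ℝ), IsEigenbasis b.op g μ :=
  exists_isEigenbasis b.isSelfAdjoint_op
    (isCompactOperator_of_traceNorm b.isSelfAdjoint_op b.traceNorm_lt_top)

theorem hasSum_eigenvalues_mul_inner {κ : Type*} {g : HilbertBasis κ ℂ H} {μ : κ → ℝ}
    {b : HermTraceClass H} (h : IsEigenbasis b.op g μ) (a : H →L[ℂ] H) :
    HasSum (fun k => (μ k : ℂ) * ⟪g k, a (g k)⟫_ℂ) (opTrace (a * b.op)) := by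
  obtain ⟨s, hs, hs'⟩ := h.hasSum_inner_mul b.isSelfAdjoint_op (hasSum_abs_eigenvalues h).summable
    a (onb H)
  convert hs
  exact hs'.tsum_eq

theorem hasSum_opTrace (b : HermTraceClass H) (a : H →L[ℂ] H) {κ : Type*}
    (e : HilbertBasis κ ℂ H) :
    HasSum (fun i => ⟪e i, a (b.op (e i))⟫_ℂ) (opTrace (a * b.op)) := by
  obtain ⟨κ', g, μ, h⟩ := b.exists_eigenbasis
  obtain ⟨s, hs, hs'⟩ := h.hasSum_inner_mul b.isSelfAdjoint_op (hasSum_abs_eigenvalues h).summable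
    a e
  rwa [(hasSum_eigenvalues_mul_inner h a).unique hs]

theorem hasSum_opTrace_self (b : HermTraceClass H) {κ : Type*} (e : HilbertBasis κ ℂ H) :
    HasSum (fun i => ⟪e i, b.op (e i)⟫_ℂ) (opTrace b.op) := by
  simpa using b.hasSum_opTrace 1 e

theorem hasSum_opPairing (a : HermBounded H) (b : HermTraceClass H) {κ : Type*}
    (e : HilbertBasis κ ℂ H) :
    HasSum (fun i => RCLike.re ⟪e i, (a : H →L[ℂ] H) (b.op (e i))⟫_ℂ) (opPairing a b) :=
  (b.hasSum_opTrace a e).mapL (RCLike.reCLM (K := ℂ))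

theorem hasSum_opPairing_eigenvalues {κ : Type*} {g : HilbertBasis κ ℂ H} {μ : κ → ℝ}
    {b : HermTraceClass H} (h : IsEigenbasis b.op g μ) (a : HermBounded H) :
    HasSum (fun k => μ k * RCLike.re ⟪g k, (a : H →L[ℂ] H) (g k)⟫_ℂ) (opPairing a b) := by
  have h1 := (hasSum_eigenvalues_mul_inner h a).mapL (RCLike.reCLM (K := ℂ))
  have h2 : (fun k => RCLike.reCLM (K := ℂ) ((μ k : ℂ) * ⟪g k, (a : H →L[ℂ] H) (g k)⟫_ℂ)) =
      fun k => μ k * RCLike.re ⟪g k, (a : H →L[ℂ] H) (g k)⟫_ℂ :=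
    funext fun k => Complex.re_ofReal_mul _ _
  rw [h2] at h1
  exact h1

omit [CompleteSpace H] in
theorem eigenvalue_nonneg {κ : Type*} {g : HilbertBasis κ ℂ H} {μ : κ → ℝ} {T : H →L[ℂ] H}
    (h : IsEigenbasis T g μ) (hT : T.IsPositive) (k : κ) : 0 ≤ μ k := by
  rw [← h.re_inner k]
  exact hT.re_inner_nonneg_right _

theorem opTrace_of_isPositive {b : HermTraceClass H} (hb : b.op.IsPositive) :
    opTrace b.op = (‖b‖ : ℂ) := by
  obtain ⟨κ, g, μ, h⟩ := b.exists_eigenbasis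
  refine (b.hasSum_opTrace_self g).unique ?_
  have h1 : HasSum (fun k => ((|μ k| : ℝ) : ℂ)) ‖b‖ :=
    (hasSum_abs_eigenvalues h).mapL Complex.ofRealCLM
  convert h1 using 2 with k
  rw [h k, inner_smul_right, inner_self_eq_norm_sq_to_K, g.orthonormal.1,
    abs_of_nonneg (eigenvalue_nonneg h hb k)]
  simp

theorem norm_of_mem_opStates {ω : HermTraceClass H} (hω : ω ∈ opStates H) : ‖ω‖ = 1 := by
  have := opTrace_of_isPositive hω.1
  rw [show opTrace ω.op = 1 from hω.2] at this
  exact_mod_cast this.symm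

theorem eq_zero_or_inv_norm_smul_mem {b : HermTraceClass H} (hb : b.op.IsPositive) :
    b = 0 ∨ ‖b‖⁻¹ • b ∈ opStates H := by
  by_cases h : b = 0
  · exact Or.inl h
  have h0 : 0 ≤ ‖b‖⁻¹ := inv_nonneg.2 (norm_nonneg b)
  have hp : (‖b‖⁻¹ • b).op.IsPositive := by
    rw [op_smul]
    rw [← ContinuousLinearMap.nonneg_iff_isPositive] at hb ⊢
    exact smul_nonneg h0 hb
  refine Or.inr ⟨hp, ?_⟩
  refine (opTrace_of_isPositive hp).trans ?_
  rw [norm_smul, norm_inv, norm_norm, inv_mul_cancel₀ (norm_ne_zero_iff.2 h), Complex.ofReal_one]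

theorem traceNorm_of_nonneg {T : H →L[ℂ] H} (hT : 0 ≤ T) {κ : Type*} (e : HilbertBasis κ ℂ H) :
    traceNorm T = diagSum e T := by
  rw [traceNorm_eq e, CFC.abs_of_nonneg T hT]

omit [CompleteSpace H] in
theorem diagSum_add {A B : H →L[ℂ] H} (hA : 0 ≤ A) (hB : 0 ≤ B) {κ : Type*}
    (e : HilbertBasis κ ℂ H) : diagSum e (A + B) = diagSum e A + diagSum e B := by
  rw [diagSum, diagSum, diagSum, ← ENNReal.tsum_add]
  refine tsum_congr fun i => ?_
  rw [← ENNReal.ofReal_add (re_inner_nonneg hA _) (re_inner_nonneg hB _), add_apply,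
    inner_add_right, map_add]

/-- The Jordan decomposition. -/
theorem exists_eq_sub_of_isPositive (a : HermTraceClass H) :
    ∃ b c : HermTraceClass H, a = b - c ∧ ‖b‖ + ‖c‖ = ‖a‖ ∧ b.op.IsPositive ∧
      c.op.IsPositive := by
  have hp := CFC.posPart_nonneg a.op
  have hn := CFC.negPart_nonneg a.op
  have hadd : traceNorm a.op = traceNorm (a.op⁺ : H →L[ℂ] H) + traceNorm (a.op⁻ : H →L[ℂ] H) := by
    rw [traceNorm_of_nonneg hp (onb H), traceNorm_of_nonneg hn (onb H), ← diagSum_add hp hn,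
      CFC.posPart_add_negPart _ a.isSelfAdjoint_op]
    rfl
  have hlt := hadd ▸ a.traceNorm_lt_top
  obtain ⟨hp', hn'⟩ := ENNReal.add_lt_top.1 hlt
  refine ⟨mk _ hp.isSelfAdjoint hp', mk _ hn.isSelfAdjoint hn', op_injective ?_, ?_,
    (ContinuousLinearMap.nonneg_iff_isPositive _).1 hp,
    (ContinuousLinearMap.nonneg_iff_isPositive _).1 hn⟩
  · rw [op_sub, op_mk, op_mk, CFC.posPart_sub_negPart _ a.isSelfAdjoint_op]
  · rw [norm_def, norm_def, norm_def, op_mk, op_mk, hadd, ENNReal.toReal_add hp'.ne hn'.ne]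

theorem traceNorm_rankOne_self (x : H) :
    traceNorm (InnerProductSpace.rankOne ℂ x x) = ENNReal.ofReal (‖x‖ ^ 2) := by
  have h0 : 0 ≤ InnerProductSpace.rankOne ℂ x x :=
    (ContinuousLinearMap.nonneg_iff_isPositive _).2 (InnerProductSpace.isPositive_rankOne_self x)
  rw [traceNorm_of_nonneg h0 (onb H), ofReal_norm_sq_eq_tsum (onb H)]
  refine tsum_congr fun i => ?_
  congr 1
  rw [InnerProductSpace.rankOne_apply, inner_smul_right, ← inner_conj_symm x, RCLike.conj_mul]
  norm_cast

/-- The rank-one operator `|x⟩⟨x|`. -/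
def ofVector (x : H) : HermTraceClass H :=
  mk (InnerProductSpace.rankOne ℂ x x)
    (InnerProductSpace.isPositive_rankOne_self x).isSelfAdjoint
    (by rw [traceNorm_rankOne_self]; exact ENNReal.ofReal_lt_top)

theorem op_ofVector (x : H) : (ofVector x).op = InnerProductSpace.rankOne ℂ x x := rfl

theorem norm_ofVector (x : H) : ‖ofVector x‖ = ‖x‖ ^ 2 := by
  rw [norm_def, op_ofVector, traceNorm_rankOne_self, ENNReal.toReal_ofReal (by positivity)]

theorem opPairing_ofVector (a : HermBounded H) (x : H) :
    opPairing a (ofVector x) = RCLike.re ⟪x, (a : H →L[ℂ] H) x⟫_ℂ := by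
  refine (hasSum_opPairing a _ (onb H)).unique ?_
  have h := ((onb H).hasSum_inner_mul_inner x ((a : H →L[ℂ] H) x)).mapL (RCLike.reCLM (K := ℂ))
  simp only [op_ofVector, InnerProductSpace.rankOne_apply, map_smul, inner_smul_right]
  exact h

theorem ofVector_mem_opStates {x : H} (hx : ‖x‖ = 1) : ofVector x ∈ opStates H := by
  have hp : (ofVector x).op.IsPositive := InnerProductSpace.isPositive_rankOne_self x
  refine ⟨hp, (opTrace_of_isPositive hp).trans ?_⟩
  rw [norm_ofVector, hx]
  simp

/-- The spectral decomposition, converging in the trace norm. -/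
theorem hasSum_smul_ofVector {κ : Type*} {g : HilbertBasis κ ℂ H} {μ : κ → ℝ}
    {b : HermTraceClass H} (h : IsEigenbasis b.op g μ) :
    HasSum (fun k => μ k • ofVector (g k)) b := by
  classical
  have hb := hasSum_abs_eigenvalues h
  rw [HasSum, SummationFilter.unconditional_filter, tendsto_iff_norm_sub_tendsto_zero]
  -- The remainder is diagonal in the same basis, with the eigenvalues in `s` replaced by 0, so its
  -- trace norm is the tail of `∑ |μ k|`.
  have hn : ∀ s : Finset κ, ‖∑ k ∈ s, μ k • ofVector (g k) - b‖ = ‖b‖ - ∑ k ∈ s, |μ k| := by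
    intro s
    rw [norm_sub_rev]
    have hd : IsEigenbasis (b - ∑ k ∈ s, μ k • ofVector (g k)).op g
        fun k => if k ∈ s then 0 else μ k := by
      intro k
      have : ∀ i, (μ i • InnerProductSpace.rankOne ℂ (g i) (g i)) (g k) =
          if i = k then (μ k : ℂ) • g k else 0 := fun i => by
        rw [smul_apply, InnerProductSpace.rankOne_apply, orthonormal_iff_ite.1 g.orthonormal]
        split_ifs with hik
        · rw [hik, one_smul, Complex.coe_smul]
        · simp
      simp only [op_sub, op_sum, op_smul, op_ofVector, sub_apply, sum_apply, this, h k,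
        Finset.sum_ite_eq']
      split_ifs <;> simp
    refine (hasSum_abs_eigenvalues hd).unique ?_
    have hs : HasSum (fun k => if k ∈ s then |μ k| else 0) (∑ k ∈ s, |μ k|) := by
      rw [← Finset.sum_congr rfl fun k hk => if_pos hk]
      exact hasSum_sum_of_ne_finset_zero fun k hk => if_neg hk
    have hk : (fun k => |if k ∈ s then 0 else μ k|) =
        fun k => |μ k| - if k ∈ s then |μ k| else 0 := by
      funext k
      split_ifs <;> simp
    rw [hk]
    exact hb.sub hs
  simp only [hn]
  have := (tendsto_const_nhds (x := ‖b‖)).sub hb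
  rwa [sub_self, SummationFilter.unconditional_filter] at this

end HermTraceClass

end HermitianTraceClass

/-! ### Hermitian operators form a state space -/

section OperatorStates

universe u

variable {H : Type u} [NormedAddCommGroup H] [InnerProductSpace ℂ H] [CompleteSpace H]

namespace HermTraceClass

/-- The operator `(|x⟩⟨y| + |y⟩⟨x|) / 2`. -/
def symRankOne (x y : H) : HermTraceClass H :=
  (1 / 4 : ℝ) • (ofVector (x + y) - ofVector (x - y))

theorem op_symRankOne_apply (x y z : H) :
    (symRankOne x y).op z = (1 / 2 : ℂ) • (⟪y, z⟫_ℂ • x + ⟪x, z⟫_ℂ • y) := by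
  rw [symRankOne, op_smul, op_sub, op_ofVector, op_ofVector, smul_apply, sub_apply,
    InnerProductSpace.rankOne_apply, InnerProductSpace.rankOne_apply, inner_add_left,
    inner_sub_left, ← Complex.coe_smul]
  push_cast
  module

theorem symRankOne_add_left (x x' y : H) :
    symRankOne (x + x') y = symRankOne x y + symRankOne x' y := by
  refine op_injective (ContinuousLinearMap.ext fun z => ?_)
  simp only [op_add, add_apply, op_symRankOne_apply, inner_add_left]
  module

theorem symRankOne_smul_left (c : ℝ) (x y : H) :
    symRankOne ((c : ℂ) • x) y = c • symRankOne x y := by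
  refine op_injective (ContinuousLinearMap.ext fun z => ?_)
  simp only [op_smul, smul_apply, op_symRankOne_apply, inner_smul_left, Complex.conj_ofReal]
  rw [← Complex.coe_smul]
  module

theorem symRankOne_comm (x y : H) : symRankOne x y = symRankOne y x := by
  refine op_injective (ContinuousLinearMap.ext fun z => ?_)
  simp only [op_symRankOne_apply, add_comm]

theorem symRankOne_I_left (x y : H) :
    symRankOne (Complex.I • x) y = -symRankOne x (Complex.I • y) := by
  rw [eq_neg_iff_add_eq_zero]
  refine op_injective (ContinuousLinearMap.ext fun z => ?_)
  have h0 : (0 : HermTraceClass H).op = 0 := map_zero (opₗ H)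
  simp only [op_add, add_apply, op_symRankOne_apply, inner_smul_left, Complex.conj_I, h0,
    zero_apply]
  module

theorem symRankOne_self (x : H) : symRankOne x x = ofVector x := by
  refine op_injective (ContinuousLinearMap.ext fun z => ?_)
  rw [op_symRankOne_apply, op_ofVector, InnerProductSpace.rankOne_apply]
  module

/-- The parallelogram law bounds the norm by `(‖x‖² + ‖y‖²) / 2`; rescaling to unit vectors improves
this to the product. -/
theorem norm_symRankOne_le (x y : H) : ‖symRankOne x y‖ ≤ ‖x‖ * ‖y‖ := by
  have key : ∀ x y : H, ‖symRankOne x y‖ ≤ (‖x‖ ^ 2 + ‖y‖ ^ 2) / 2 := fun x y => by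
    have h1 := norm_sub_le (ofVector (x + y)) (ofVector (x - y))
    have h2 := parallelogram_law_with_norm ℂ x y
    rw [norm_ofVector, norm_ofVector] at h1
    rw [symRankOne, norm_smul]
    norm_num
    nlinarith
  have hunit : ∀ x y : H, ‖x‖ = 1 → ‖y‖ = 1 → ‖symRankOne x y‖ ≤ 1 := fun x y hx hy => by
    have := key x y
    rw [hx, hy] at this
    linarith
  have hscale : ∀ x : H, ∃ v : H, x = ((‖x‖ : ℝ) : ℂ) • v ∧ (x = 0 ∨ ‖v‖ = 1) := fun x => by
    rcases eq_or_ne x 0 with rfl | hx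
    · exact ⟨0, by simp, Or.inl rfl⟩
    · have hx' : ((‖x‖ : ℝ) : ℂ) ≠ 0 := by simpa using hx
      exact ⟨((‖x‖ : ℝ) : ℂ)⁻¹ • x, by rw [smul_inv_smul₀ hx'],
        Or.inr (by rw [norm_smul, norm_inv, Complex.norm_real, norm_norm,
          inv_mul_cancel₀ (norm_ne_zero_iff.2 hx)])⟩
  obtain ⟨v, hv, hv'⟩ := hscale x
  obtain ⟨w, hw, hw'⟩ := hscale y
  have hxy : ‖symRankOne x y‖ = ‖x‖ * ‖y‖ * ‖symRankOne v w‖ := by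
    conv_lhs => rw [hv, hw, symRankOne_smul_left, symRankOne_comm, symRankOne_smul_left,
      symRankOne_comm, norm_smul, norm_smul, norm_norm, norm_norm, ← mul_assoc]
  rw [hxy]
  rcases hv' with rfl | hv'
  · simp
  rcases hw' with rfl | hw'
  · simp
  exact mul_le_of_le_one_right (by positivity) (hunit v w hv' hw')

/-! ### Functionals on the Hermitian trace class as bounded Hermitian operators -/

variable (φ : HermTraceClass H →L[ℝ] ℝ)

/-- The sesquilinear form whose quadratic form is `φ |x⟩⟨x|`. -/
def sesqForm (x y : H) : ℂ :=
  φ (symRankOne x y) - Complex.I * φ (symRankOne x (Complex.I • y))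

theorem sesqForm_add_left (x x' y : H) :
    sesqForm φ (x + x') y = sesqForm φ x y + sesqForm φ x' y := by
  simp only [sesqForm, symRankOne_add_left, map_add, Complex.ofReal_add]
  ring

theorem conj_sesqForm (x y : H) : (starRingEnd ℂ) (sesqForm φ x y) = sesqForm φ y x := by
  simp only [sesqForm, map_sub, map_mul, Complex.conj_ofReal, Complex.conj_I]
  rw [symRankOne_comm y x, symRankOne_comm y, symRankOne_I_left, map_neg]
  push_cast
  ring

theorem sesqForm_ofReal_smul_left (c : ℝ) (x y : H) :
    sesqForm φ ((c : ℂ) • x) y = c * sesqForm φ x y := by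
  simp only [sesqForm, symRankOne_smul_left, map_smul, smul_eq_mul, Complex.ofReal_mul]
  ring

theorem sesqForm_I_smul_left (x y : H) :
    sesqForm φ (Complex.I • x) y = -Complex.I * sesqForm φ x y := by
  have h : symRankOne x (Complex.I • Complex.I • y) = -symRankOne x y := by
    rw [smul_smul, Complex.I_mul_I, symRankOne_comm, symRankOne_comm x,
      show (-1 : ℂ) • y = ((-1 : ℝ) : ℂ) • y by simp, symRankOne_smul_left, neg_one_smul]
  simp only [sesqForm, symRankOne_I_left, h, map_neg, neg_neg, Complex.ofReal_neg]
  linear_combination -(φ (symRankOne x (Complex.I • y)) : ℂ) * Complex.I_mul_I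

theorem sesqForm_smul_left (c : ℂ) (x y : H) :
    sesqForm φ (c • x) y = (starRingEnd ℂ) c * sesqForm φ x y := by
  have hc : c • x = (c.re : ℂ) • x + (c.im : ℂ) • Complex.I • x := by
    conv_lhs => rw [← Complex.re_add_im c]
    module
  rw [hc, sesqForm_add_left, sesqForm_ofReal_smul_left, sesqForm_ofReal_smul_left,
    sesqForm_I_smul_left]
  conv_rhs => rw [← Complex.re_add_im c, map_add, map_mul, Complex.conj_ofReal,
    Complex.conj_ofReal, Complex.conj_I]
  ring

/-- The constant 2 comes from estimating the real and imaginary parts separately; only boundedness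
is needed. -/
theorem norm_sesqForm_le (x y : H) : ‖sesqForm φ x y‖ ≤ 2 * ‖φ‖ * ‖x‖ * ‖y‖ := by
  have h : ∀ y : H, ‖(φ (symRankOne x y) : ℂ)‖ ≤ ‖φ‖ * (‖x‖ * ‖y‖) := fun y => by
    rw [Complex.norm_real]
    exact (φ.le_opNorm _).trans
      (mul_le_mul_of_nonneg_left (norm_symRankOne_le x y) (norm_nonneg _))
  have h1 := h y
  have h2 := h (Complex.I • y)
  rw [norm_smul, Complex.norm_I, one_mul] at h2
  refine (norm_sub_le _ _).trans ?_
  rw [norm_mul, Complex.norm_I, one_mul]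
  linarith

/-- `sesqForm` as a bounded sesquilinear map. -/
def sesqFormL : H →L⋆[ℂ] H →L[ℂ] ℂ :=
  LinearMap.mkContinuous₂
    (LinearMap.mk₂'ₛₗ (starRingEnd ℂ) (RingHom.id ℂ) (sesqForm φ) (sesqForm_add_left φ)
      (sesqForm_smul_left φ)
      (fun x y y' => by
        rw [← conj_sesqForm, sesqForm_add_left, map_add, conj_sesqForm, conj_sesqForm])
      (fun c x y => by
        rw [← conj_sesqForm, sesqForm_smul_left, map_mul, conj_sesqForm, Complex.conj_conj]
        rfl))
    (2 * ‖φ‖) (norm_sesqForm_le φ)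

theorem re_sesqForm_self (x : H) : (sesqForm φ x x).re = φ (ofVector x) := by
  rw [← symRankOne_self]
  simp [sesqForm]

/-- Every continuous functional on the Hermitian trace-class operators is `tr (f ·)` for a bounded
Hermitian operator `f`. -/
theorem exists_opPairing_eq : ∃ f : HermBounded H, ∀ b, opPairing f b = φ b := by
  let A := InnerProductSpace.continuousLinearMapOfBilin (sesqFormL φ)
  have hA : ∀ x y, ⟪A x, y⟫_ℂ = sesqForm φ x y := fun x y =>
    InnerProductSpace.continuousLinearMapOfBilin_apply _ x y
  have hsa : IsSelfAdjoint A := by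
    rw [ContinuousLinearMap.isSelfAdjoint_iff_isSymmetric]
    intro x y
    show ⟪A x, y⟫_ℂ = ⟪x, A y⟫_ℂ
    rw [hA, ← inner_conj_symm x, hA, conj_sesqForm]
  refine ⟨⟨A, hsa⟩, fun b => ?_⟩
  obtain ⟨κ, g, μ, h⟩ := b.exists_eigenbasis
  refine (hasSum_opPairing_eigenvalues h _).unique ?_
  -- Pairing with `A` and `φ` agree on each `|x⟩⟨x|`, and the spectral decomposition of `b`
  -- converges in trace norm.
  have h1 := (hasSum_smul_ofVector h).mapL φ
  have h2 : ∀ k, φ (μ k • ofVector (g k)) = μ k * RCLike.re ⟪g k, A (g k)⟫_ℂ := fun k => by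
    rw [map_smul, smul_eq_mul, ← re_sesqForm_self, ← hA, ← inner_conj_symm, Complex.conj_re]
    rfl
  simp only [h2] at h1
  exact h1

end HermTraceClass

/-! ### The trace pairing as a state duality -/

open HermTraceClass

variable (H) in
/-- `opPairing` as a bilinear map. -/
def opPairingₗ : HermBounded H →ₗ[ℝ] HermTraceClass H →ₗ[ℝ] ℝ :=
  LinearMap.mk₂ ℝ opPairing
    (fun a a' b => (hasSum_opPairing _ _ (onb H)).unique <| by
      simpa only [AddSubgroup.coe_add, add_apply, inner_add_right, map_add] using
        (hasSum_opPairing a b (onb H)).add (hasSum_opPairing a' b (onb H)))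
    (fun c a b => (hasSum_opPairing _ _ (onb H)).unique <| by
      simpa only [selfAdjoint.val_smul, smul_apply, inner_smul_right_eq_smul, RCLike.smul_re,
        smul_eq_mul] using (hasSum_opPairing a b (onb H)).mul_left c)
    (fun a b b' => (hasSum_opPairing _ _ (onb H)).unique <| by
      simpa only [op_add, add_apply, inner_add_right, map_add] using
        (hasSum_opPairing a b (onb H)).add (hasSum_opPairing a b' (onb H)))
    (fun c a b => (hasSum_opPairing _ _ (onb H)).unique <| by
      have h := (hasSum_opPairing a b (onb H)).mul_left c
      simp only [op_smul, smul_apply, ← Complex.coe_smul, map_smul, inner_smul_right]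
      simp only [← Complex.re_ofReal_mul, RCLike.re_to_complex] at h ⊢
      exact h)

theorem opPairingₗ_apply (a : HermBounded H) (b : HermTraceClass H) :
    opPairingₗ H a b = opPairing a b := rfl

/-- For Hermitian operators the diagonal entries of `a b` and `b a` are complex conjugates, so the
real parts agree term by term. -/
theorem opPairing_comm (a b : HermTraceClass H) :
    opPairing a.toBounded b = opPairing b.toBounded a := by
  refine (hasSum_opPairing _ _ (onb H)).unique ?_
  have h := hasSum_opPairing b.toBounded a (onb H)
  convert h using 2 with i
  have ha : ⟪a.op (onb H i), b.op (onb H i)⟫_ℂ = ⟪onb H i, a.op (b.op (onb H i))⟫_ℂ :=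
    a.isSelfAdjoint_op.isSymmetric _ _
  have hb : ⟪b.op (onb H i), a.op (onb H i)⟫_ℂ = ⟪onb H i, b.op (a.op (onb H i))⟫_ℂ :=
    b.isSelfAdjoint_op.isSymmetric _ _
  rw [← ha, ← hb, ← inner_conj_symm, RCLike.conj_re]

theorem opPairing_self_eq_zero {a : HermTraceClass H} (ha : opPairing a.toBounded a = 0) :
    a = 0 := by
  obtain ⟨κ, g, μ, h⟩ := a.exists_eigenbasis
  have h1 := hasSum_opPairing_eigenvalues h a.toBounded
  simp only [h.re_inner, ha] at h1
  have h2 := (hasSum_zero_iff_of_nonneg fun k => mul_self_nonneg (μ k)).1 h1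
  have h3 := hasSum_abs_eigenvalues h
  have h4 : ∀ k, μ k = 0 := fun k => mul_self_eq_zero.1 (congrFun h2 k)
  simp only [h4, abs_zero] at h3
  exact norm_eq_zero.1 (h3.unique hasSum_zero)

theorem abs_opPairing_le (a : HermBounded H) (b : HermTraceClass H) :
    |opPairing a b| ≤ ‖a‖ * ‖b‖ := by
  obtain ⟨κ, g, μ, h⟩ := b.exists_eigenbasis
  have hb := (hasSum_abs_eigenvalues h).mul_left ‖a‖
  rw [← (hasSum_opPairing_eigenvalues h a).tsum_eq, ← Real.norm_eq_abs]
  refine tsum_of_norm_bounded hb fun k => ?_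
  rw [Real.norm_eq_abs, abs_mul, mul_comm]
  refine mul_le_mul_of_nonneg_right ?_ (abs_nonneg _)
  calc |RCLike.re ⟪g k, (a : H →L[ℂ] H) (g k)⟫_ℂ| ≤ ‖g k‖ * ‖(a : H →L[ℂ] H) (g k)‖ :=
        (RCLike.abs_re_le_norm _).trans (norm_inner_le_norm _ _)
    _ ≤ ‖(a : H →L[ℂ] H)‖ := by
        simpa [g.orthonormal.1 k] using (a : H →L[ℂ] H).le_opNorm (g k)

/-- Testing on `|x⟩⟨x|` bounds the Rayleigh quotients of `f`, whose supremum in absolute value is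
the norm of a symmetric operator. -/
theorem norm_le_of_abs_opPairing_le {f : HermBounded H} {C : ℝ} (hC : 0 ≤ C)
    (h : ∀ b, |opPairing f b| ≤ C * ‖b‖) : ‖f‖ ≤ C := by
  have hs : (f : H →L[ℂ] H).IsSymmetric := f.2.isSymmetric
  show ‖(f : H →L[ℂ] H)‖ ≤ C
  rw [ContinuousLinearMap.norm_eq_iSup_rayleighQuotient _ hs]
  refine ciSup_le fun x => ?_
  have h1 := h (ofVector x)
  rw [opPairing_ofVector, norm_ofVector] at h1
  rw [ContinuousLinearMap.rayleighQuotient, abs_div, abs_sq,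
    ContinuousLinearMap.reApplyInnerSelf_apply]
  refine div_le_of_le_mul₀ (by positivity) hC ?_
  rwa [← inner_conj_symm, RCLike.conj_re]

variable (H) in
theorem isStateDuality_op :
    IsStateDuality (F := HermBounded H) (toBoundedₗ H) (opPairingₗ H) (opStates H) where
  symm := opPairing_comm
  definite _ := opPairing_self_eq_zero
  bound := abs_opPairing_le
  norming _ _ := norm_le_of_abs_opPairing_le
  surj := exists_opPairing_eq
  norm_state _ hω := (norm_of_mem_opStates hω).le
  decomp a := by
    obtain ⟨b, c, h, hn, hb, hc⟩ := a.exists_eq_sub_of_isPositive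
    exact ⟨b, c, h, hn.le, eq_zero_or_inv_norm_smul_mem hb, eq_zero_or_inv_norm_smul_mem hc⟩

variable (H) in
theorem hasSpectralEntropy_op :
    HasSpectralEntropy.{u, u, u} (F := HermBounded H) (toBoundedₗ H) (opPairingₗ H)
      (opStates H) opEntropy where
  pairing_nonneg ρ hρ σ hσ := by
    obtain ⟨κ, g, μ, h⟩ := σ.exists_eigenbasis
    exact (hasSum_opPairing_eigenvalues h ρ.toBounded).nonneg fun k =>
      mul_nonneg (eigenvalue_nonneg h hσ.1 k) (hρ.1.re_inner_nonneg_right _)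
  spectral ω hω := by
    obtain ⟨κ, g, μ, h⟩ := ω.exists_eigenbasis
    have hμ0 := fun k => eigenvalue_nonneg h hω.1 k
    have hμ := hasSum_abs_eigenvalues h
    -- The pure states run over the whole eigenbasis, kernel included, so that pairing `ρ` with all
    -- of them sums to `tr ρ = 1`.
    refine ⟨κ, fun k => ofVector (g k), μ, fun k => ofVector_mem_opStates (g.orthonormal.1 k),
      hμ0, fun k => ?_, fun f => ?_, fun ρ hρ => ?_, fun k => ?_, ?_⟩
    · rw [norm_of_mem_opStates hω] at hμ
      exact (le_abs_self _).trans (le_hasSum hμ k fun _ _ => abs_nonneg _)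
    · simp only [opPairingₗ_apply, opPairing_ofVector]
      exact hasSum_opPairing_eigenvalues h f
    · simp only [opPairingₗ_apply, opPairing_ofVector]
      have h1 := (ρ.hasSum_opTrace_self g).mapL (RCLike.reCLM (K := ℂ))
      rw [show opTrace ρ.op = 1 from hρ.2, RCLike.reCLM_apply, RCLike.one_re] at h1
      exact h1
    · rw [(isStateDuality_op H).symm, opPairingₗ_apply, opPairing_ofVector]
      exact h.re_inner k
    · exact h.tsum_finrank_mul ω.isSelfAdjoint_op hμ.summable
        (f := fun t => ENNReal.ofReal (Real.negMulLog t)) (by simp)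

end OperatorStates

end

theorem mainTheorem4 (ι : Type*) [Countable ι]
    (H : Type*) [NormedAddCommGroup H] [InnerProductSpace ℂ H] [CompleteSpace H]
    [TopologicalSpace.SeparableSpace H] :
    -- case S
    (∀ X : Submodule ℝ (SeqL1 ι), IsClosed (X : Set (SeqL1 ι)) →
      (Submodule.span ℝ ((X : Set (SeqL1 ι)) ∩ seqStates ι)).topologicalClosure = X →
      (∀ ω ∈ seqStates ι, ∃ ωX,
        IsCondExpectation SeqL1.toLinf seqPairing (seqStates ι) X ω ωX) →
      (∃ (π₁ : SeqL1 ι →L[ℝ] SeqL1 ι) (π₂ : SeqLinf ι →L[ℝ] SeqLinf ι),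
        IsProjectionAlong π₁ X (SeqL1.toLinf ⁻¹' annihilator seqPairing (X : Set (SeqL1 ι))) ∧
        IsProjectionAlong π₂
          (closure[weakStarTopology seqPairing] (SeqL1.toLinf '' X)) (annihilator seqPairing (X : Set (SeqL1 ι))) ∧
        (∀ a, π₂ (SeqL1.toLinf a) = SeqL1.toLinf (π₁ a)) ∧
        (∀ a, ‖π₁ a‖ ≤ ‖a‖) ∧
        (∀ a, ‖π₂ a‖ ≤ ‖a‖) ∧
        (∀ ω ∈ seqStates ι, ∀ ωX,
          IsCondExpectation SeqL1.toLinf seqPairing (seqStates ι) X ω ωX ↔ ωX = π₁ ω)) ∧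
      ∀ ω ∈ seqStates ι, ∀ ωX,
        IsCondExpectation SeqL1.toLinf seqPairing (seqStates ι) X ω ωX →
          seqEntropy ω ≤ seqEntropy ωX) ∧
    -- case O
    (∀ X : Submodule ℝ (HermTraceClass H), IsClosed (X : Set (HermTraceClass H)) →
      (Submodule.span ℝ ((X : Set (HermTraceClass H)) ∩ opStates H)).topologicalClosure = X →
      (∀ ω ∈ opStates H, ∃ ωX,
        IsCondExpectation HermTraceClass.toBounded opPairing (opStates H) X ω ωX) →
      (∃ (π₁ : HermTraceClass H →L[ℝ] HermTraceClass H)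
          (π₂ : HermBounded H →L[ℝ] HermBounded H),
        IsProjectionAlong π₁ X (HermTraceClass.toBounded ⁻¹' annihilator opPairing (X : Set (HermTraceClass H))) ∧
        IsProjectionAlong π₂
          (closure[weakStarTopology opPairing] (HermTraceClass.toBounded '' X))
          (annihilator opPairing (X : Set (HermTraceClass H))) ∧
        (∀ a, π₂ (HermTraceClass.toBounded a) = HermTraceClass.toBounded (π₁ a)) ∧
        (∀ a, ‖π₁ a‖ ≤ ‖a‖) ∧
        (∀ a, ‖π₂ a‖ ≤ ‖a‖) ∧
        (∀ ω ∈ opStates H, ∀ ωX,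
          IsCondExpectation HermTraceClass.toBounded opPairing (opStates H) X ω ωX ↔
            ωX = π₁ ω)) ∧
      ∀ ω ∈ opStates H, ∀ ωX,
        IsCondExpectation HermTraceClass.toBounded opPairing (opStates H) X ω ωX →
          opEntropy ω ≤ opEntropy ωX) := by
  refine ⟨fun X _ _ hX => ?_, fun X _ _ hX => ?_⟩
  · exact ⟨(isStateDuality_seq ι).exists_projections hX, fun _ hω _ hωX =>
      (isStateDuality_seq ι).entropy_le (hasSpectralEntropy_seq ι) hX hω hωX⟩
  · exact ⟨(isStateDuality_op H).exists_projections hX, fun _ hω _ hωX =>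
      (isStateDuality_op H).entropy_le (hasSpectralEntropy_op H) hX hω hωX⟩
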